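/- **Setting.** Let $K\ge 2$, $[n]=\{1,\dots,n\}$, and let $\nu=(\nu_k)_{k\in[K]}$ be probability laws on $\mathbb R$ with means $\mu=(\mu_k)_{k\in[K]}$ that are $1$-sub-Gaussian: $\mathbb E_{X\sim\nu_k}[e^{\lambda(X-\mu_k)}]\le e^{\lambda^2/2}$ for all $\lambda\in\mathbb R$. Put $\mu_\star=\max_k\mu_k$, $i^\star(\mu)=\{k:\mu_k=\mu_\star\}$ and $\mathcal I_\varepsilon(\mu)=\{k:\mu_k\ge\mu_\star-\varepsilon\}$. At each time $n\ge 1$ an arm $I_n$ is pulled and a reward $X_n$ is observed whose conditional law, given $\mathcal F_n=\sigma((I_t,X_t):1\le t<n)$ and $I_n$, is $\nu_{I_n}$. Let $N_{n,k}$ be the number of pulls of arm $k$ before time $n$ and $\mu_{n,k}$ the average of the rewards obtained from these pulls. **Algorithm** EB-TC$_{\varepsilon_0}$ with slack $\varepsilon_0>0$ and fixed proportion $\beta=1/2$. During the first $K$ rounds each arm is pulled once. At each time $n>K$ the recommendation and leader is $\hat\imath_n=B_n\in\arg\max_k\mu_{n,k}$ and the challenger is $$C_n\in\arg\min_{k\ne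 B_n}\frac{\mu_{n,B_n}-\mu_{n,k}+\varepsilon_0}{\sqrt{1/N_{n,B_n}+1/N_{n,k}}},$$ with ties broken arbitrarily. Let $T_n(i,j)$ be the number of $t$ with $K<t<n$ and $(B_t,C_t)=(i,j)$, and $N^i_{n,j}$ the number of those $t$ with, in addition, $I_t=j$. Then $I_n=C_n$ if $N^{B_n}_{n,C_n}\le\tfrac12 T_{n+1}(B_n,C_n)$, and $I_n=B_n$ otherwise. **Complexities.** Let $0=\Delta_1<\dots<\Delta_{C_\mu}$ be the distinct values of the gaps $\mu_\star-\mu_k$, $C_\mu=|\{\mu_k:k\in[K]\}|$, and $\mathcal C_\mu(i)=\{k:\mu_\star-\mu_k=\Delta_i\}$. For $\varepsilon\ge0$ let $i_\mu(\varepsilon)=i$ if $\varepsilon\in[\Delta_i,\Delta_{i+1})$ with $i\in[C_\mu-1]$, and $i_\mu(\varepsilon)=C_\mu$ otherwise. Let $C_i(\varepsilon_0)=2\Delta_i^{-1}-\varepsilon_0^{-1}$ and $C_{i,j}(\varepsilon_0)=2\frac{\Delta_j/\varepsilon_0+1}{\Delta_i-\Delta_j}+3\varepsilon_0^{-1}$.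 For $i\in[C_\mu-1]$ let $H_i(\mu,\varepsilon_0)=\min_{j\in[i]}\max\{\bar H_{i,j},\tilde H_{i,j}\}$, where $$\begin{aligned}\bar H_{i,j}={}&|i^\star(\mu)|\max\{\sqrt2\,\Delta_{j+1}^{-1},C_{i+1,j}(\varepsilon_0)\}^2+\max\{C_{j+1}(\varepsilon_0),C_{i+1,j}(\varepsilon_0)\}^2\Big(\sum_{k=2}^{j}|\mathcal C_\mu(k)|+\sum_{k=i+1}^{C_\mu}|\mathcal C_\mu(k)|\Big)\\&+\sum_{k=j+1}^{i}|\mathcal C_\mu(k)|\max\{C_{j+1}(\varepsilon_0),C_{i+1,j}(\varepsilon_0),\sqrt2\,\Delta_k^{-1}\}^2,\end{aligned}$$ $$\begin{aligned}\tilde H_{i,j}={}&\frac{2|i^\star(\mu)|}{\Delta_{j+1}^2}+\max\{C_{j+1}(\varepsilon_0),\varepsilon_0^{-1}\}^2\sum_{k=2}^{j}|\mathcal C_\mu(k)|+\frac{2\sum_{k=1}^{j}|\mathcal C_\mu(k)|}{(\Delta_{i+1}-\Delta_j)^2}\\&+\sum_{k=j+1}^{C_\mu}|\mathcal C_\mu(k)|\max\{C_{j+1}(\varepsilon_0),\varepsilon_0^{-1},\sqrt2\,\Delta_k^{-1}\}^2.\end{aligned}$$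 Let $\overline W_{-1}(x)=-W_{-1}(-e^{-x})$ for $x\ge1$, with $W_{-1}$ the negative branch of the Lambert function, $h_2(L,A,B)=2A\,\overline W_{-1}\big(\tfrac12L+\tfrac{B}{2A}+\log(2A)\big)$, and, for $i\in[C_\mu-1]$ and $\delta\in(0,1)$, $$U_{i,\delta}(\mu,\varepsilon_0)=h_2\big(\log(1/\delta),\,8H_i(\mu,\varepsilon_0),\,8H_i(\mu,\varepsilon_0)\log(K(K+1)/2)+5K^2/2\big).$$ Put $U_{C_\mu,\delta}(\mu,\varepsilon_0)=K$ (for $i_\mu(\varepsilon)=C_\mu$ all arms are $\varepsilon$-good, and recommendations start after time $K$). **Theorem.** For EB-TC$_{\varepsilon_0}$ with $\beta=1/2$, for all $\varepsilon_0>0$, all $\nu$ as above, all $\delta\in(0,1)$ and all $\varepsilon\ge0$ (neither $\varepsilon$ nor $\delta$ is a parameter of the algorithm): 1. $\mathbb P_\nu\big(\forall n>U_{i_\mu(\varepsilon),\delta}(\mu,\varepsilon_0):\ \hat\imath_n\in\mathcal I_\varepsilon(\mu)\big)\ge1-\delta$. 2. Consequently the $(\varepsilon,\delta)$-unverifiable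 sample complexity, i.e. the infimum of $\mathbb E_\nu[\tau]$ over stopping times $\tau>K$ of $(\mathcal F_n)_n$ with $\mathbb P_\nu(\forall n\ge\tau:\ \hat\imath_n\in\mathcal I_\varepsilon(\mu))\ge1-\delta$, is at most $\lfloor U_{i_\mu(\varepsilon),\delta}(\mu,\varepsilon_0)\rfloor+1$. 3. For all $A>0$ and $B\in\mathbb R$, $h_2(\log(1/\delta),A,B)=A\log(1/\delta)+O(\log\log(1/\delta))$ as $\delta\to0$; in particular, for all $i\in[C_\mu-1]$, $U_{i,\delta}(\mu,\varepsilon_0)=8H_i(\mu,\varepsilon_0)\log(1/\delta)+O(\log\log(1/\delta))$. -/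

import Mathlib

open MeasureTheory ProbabilityTheory Filter Topology Asymptotics
open scoped ENNReal NNReal

/-! ### Bandit instances: means, gaps and good arms. Arms are indexed by `Fin K`. -/

/-- The mean `μ_k` of each arm of the instance `ν`. -/
noncomputable def armMean {K : ℕ} (ν : Fin K → Measure ℝ) : Fin K → ℝ :=
  fun k => ∫ x, x ∂(ν k)

/-- A law on `ℝ` is `1`-sub-Gaussian: `E[exp (l (X - E X))] ≤ exp (l ^ 2 / 2)` for all real `l`
(with integrability of the exponentials). -/
def IsOneSubGaussian (ρ : Measure ℝ) : Prop :=
  HasSubgaussianMGF (fun x => x - ∫ y, y ∂ρ) 1 ρ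

/-- The largest mean `μ_⋆`. -/
noncomputable def maxMean {K : ℕ} (μ : Fin K → ℝ) : ℝ := ⨆ k, μ k

/-- The set `I_ε(μ)` of `ε`-good arms. -/
def goodArms {K : ℕ} (μ : Fin K → ℝ) (ε : ℝ) : Set (Fin K) := {k | maxMean μ - ε ≤ μ k}

/-- The set `i^⋆(μ)` of best arms. -/
noncomputable def bestArms {K : ℕ} (μ : Fin K → ℝ) : Finset (Fin K) :=
  Finset.univ.filter (fun k => μ k = maxMean μ)

/-- The number `C_μ` of distinct means. -/
noncomputable def numClasses {K : ℕ} (μ : Fin K → ℝ) : ℕ := (Finset.univ.image μ).card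

/-- The finite set of the gaps `μ_⋆ - μ_k`. -/
noncomputable def gapSet {K : ℕ} (μ : Fin K → ℝ) : Finset ℝ :=
  Finset.univ.image (fun k => maxMean μ - μ k)

theorem card_gapSet {K : ℕ} (μ : Fin K → ℝ) : (gapSet μ).card = numClasses μ := by
  have h : gapSet μ = (Finset.univ.image μ).image (fun x => maxMean μ - x) := by
    simp [gapSet, Finset.image_image, Function.comp_def]
  rw [h, numClasses]
  exact Finset.card_image_of_injective _ (fun a b hab => by simpa using hab)

/-- The distinct gaps `0 = Δ_1 < Δ_2 < ⋯ < Δ_{C_μ}` in increasing order; the index starts at `1`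
(and the value is irrelevant for indices outside `1, …, C_μ`). -/
noncomputable def sortedGap {K : ℕ} (μ : Fin K → ℝ) (i : ℕ) : ℝ :=
  if h : i - 1 < numClasses μ then (gapSet μ).orderEmbOfFin (card_gapSet μ) ⟨i - 1, h⟩ else 0

/-- The size of the class `C_μ(i)` of the arms whose gap is `Δ_i`. -/
noncomputable def classSize {K : ℕ} (μ : Fin K → ℝ) (i : ℕ) : ℕ :=
  (Finset.univ.filter (fun k => maxMean μ - μ k = sortedGap μ i)).card

/-- The indices `i ∈ [C_μ - 1]` such that `ε ∈ [Δ_i, Δ_{i+1})`. -/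
def classIndexSet {K : ℕ} (μ : Fin K → ℝ) (ε : ℝ) : Set ℕ :=
  {i | 1 ≤ i ∧ i < numClasses μ ∧ sortedGap μ i ≤ ε ∧ ε < sortedGap μ (i + 1)}

open Classical in
/-- The index `i_μ(ε)`: it is `i` if `ε ∈ [Δ_i, Δ_{i+1})` with `i ∈ [C_μ - 1]`, else `C_μ`. -/
noncomputable def classIndex {K : ℕ} (μ : Fin K → ℝ) (ε : ℝ) : ℕ :=
  if (classIndexSet μ ε).Nonempty then sInf (classIndexSet μ ε) else numClasses μ

/-! ### Complexities -/

/-- `C_i(ε₀) = 2 / Δ_i - 1 / ε₀`. -/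
noncomputable def cOne {K : ℕ} (μ : Fin K → ℝ) (ε₀ : ℝ) (i : ℕ) : ℝ :=
  2 * (sortedGap μ i)⁻¹ - ε₀⁻¹

/-- `C_{i,j}(ε₀) = 2 (Δ_j / ε₀ + 1) / (Δ_i - Δ_j) + 3 / ε₀`. -/
noncomputable def cTwo {K : ℕ} (μ : Fin K → ℝ) (ε₀ : ℝ) (i j : ℕ) : ℝ :=
  2 * ((sortedGap μ j / ε₀ + 1) / (sortedGap μ i - sortedGap μ j)) + 3 * ε₀⁻¹

/-- The complexity `\bar H_{i,j}(μ, ε₀)`. -/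
noncomputable def hBar {K : ℕ} (μ : Fin K → ℝ) (ε₀ : ℝ) (i j : ℕ) : ℝ :=
  ((bestArms μ).card : ℝ) *
      (max (Real.sqrt 2 * (sortedGap μ (j + 1))⁻¹) (cTwo μ ε₀ (i + 1) j)) ^ 2
    + (max (cOne μ ε₀ (j + 1)) (cTwo μ ε₀ (i + 1) j)) ^ 2 *
      ((∑ k ∈ Finset.Icc 2 j, (classSize μ k : ℝ))
        + ∑ k ∈ Finset.Icc (i + 1) (numClasses μ), (classSize μ k : ℝ))
    + ∑ k ∈ Finset.Icc (j + 1) i, (classSize μ k : ℝ) *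
      (max (max (cOne μ ε₀ (j + 1)) (cTwo μ ε₀ (i + 1) j))
        (Real.sqrt 2 * (sortedGap μ k)⁻¹)) ^ 2

/-- The complexity `\tilde H_{i,j}(μ, ε₀)`. -/
noncomputable def hTilde {K : ℕ} (μ : Fin K → ℝ) (ε₀ : ℝ) (i j : ℕ) : ℝ :=
  2 * ((bestArms μ).card : ℝ) / (sortedGap μ (j + 1)) ^ 2
    + (max (cOne μ ε₀ (j + 1)) ε₀⁻¹) ^ 2 * ∑ k ∈ Finset.Icc 2 j, (classSize μ k : ℝ)
    + 2 * (∑ k ∈ Finset.Icc 1 j, (classSize μ k : ℝ)) /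
        (sortedGap μ (i + 1) - sortedGap μ j) ^ 2
    + ∑ k ∈ Finset.Icc (j + 1) (numClasses μ), (classSize μ k : ℝ) *
      (max (max (cOne μ ε₀ (j + 1)) ε₀⁻¹) (Real.sqrt 2 * (sortedGap μ k)⁻¹)) ^ 2

/-- `H_i(μ, ε₀) = min_{j ∈ [i]} max {\bar H_{i,j}(μ, ε₀), \tilde H_{i,j}(μ, ε₀)}`,
for `i ∈ [C_μ - 1]`. -/
noncomputable def complexityH {K : ℕ} (μ : Fin K → ℝ) (ε₀ : ℝ) (i : ℕ) : ℝ :=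
  ⨅ j : Finset.Icc 1 i, max (hBar μ ε₀ i j) (hTilde μ ε₀ i j)

/-- The branch `W_{-1}` of the Lambert function: for `y ∈ [-1/e, 0)` it is the unique `w ≤ -1`
with `w * exp w = y`. -/
noncomputable def lambertWNegOne (y : ℝ) : ℝ :=
  Function.invFunOn (fun w : ℝ => w * Real.exp w) (Set.Iic (-1)) y

/-- `\bar W_{-1}(x) = - W_{-1}(- e^{-x})`, for `x ≥ 1`. -/
noncomputable def lambertWBar (x : ℝ) : ℝ := - lambertWNegOne (- Real.exp (-x))

/-- `h_2(L, A, B) = 2 A \bar W_{-1}(L / 2 + B / (2 A) + log (2 A))`. -/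
noncomputable def hTwo (L A B : ℝ) : ℝ :=
  2 * A * lambertWBar (1 / 2 * L + B / (2 * A) + Real.log (2 * A))

/-- The time `U_{i,δ}(μ, ε₀)` for `i ∈ [C_μ - 1]`. For `i = C_μ`, where all arms are good,
the value is `K`, the last time before recommendations start. -/
noncomputable def unverifiableTime {K : ℕ} (μ : Fin K → ℝ) (ε₀ : ℝ) (i : ℕ) (δ : ℝ) : ℝ :=
  if i < numClasses μ then
    hTwo (Real.log (1 / δ)) (8 * complexityH μ ε₀ i)
      (8 * complexityH μ ε₀ i * Real.log ((K : ℝ) * ((K : ℝ) + 1) / 2) + 5 * (K : ℝ) ^ 2 / 2)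
  else (K : ℝ)

/-! ### The algorithm. Times start at `1`; values of the processes at time `0` play no role. -/

section Algorithm

variable {Ω : Type*} {K : ℕ}

/-- `N_{n,k}`, the number of pulls of the arm `k` before time `n`. -/
def pulls (I : ℕ → Ω → Fin K) (n : ℕ) (k : Fin K) (ω : Ω) : ℕ :=
  ((Finset.Ico 1 n).filter (fun t => I t ω = k)).card

/-- `μ_{n,k}`, the empirical mean of the arm `k` before time `n`. -/
noncomputable def empMean (I : ℕ → Ω → Fin K) (X : ℕ → Ω → ℝ) (n : ℕ) (k : Fin K) (ω : Ω) : ℝ :=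
  (∑ t ∈ (Finset.Ico 1 n).filter (fun t => I t ω = k), X t ω) / (pulls I n k ω : ℝ)

/-- The empirical transportation cost with slack `ε₀` of the arm `k` against the leader `b`. -/
noncomputable def transportCost (ε₀ : ℝ) (I : ℕ → Ω → Fin K) (X : ℕ → Ω → ℝ) (n : ℕ)
    (b k : Fin K) (ω : Ω) : ℝ :=
  (empMean I X n b ω - empMean I X n k ω + ε₀) /
    Real.sqrt (1 / (pulls I n b ω : ℝ) + 1 / (pulls I n k ω : ℝ))

/-- `T_n(i,j)`, the number of rounds before time `n`, after the initialization, with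
leader `i` and challenger `j`. -/
def pairCount (B C : ℕ → Ω → Fin K) (n : ℕ) (i j : Fin K) (ω : Ω) : ℕ :=
  ((Finset.Ioo K n).filter (fun t => B t ω = i ∧ C t ω = j)).card

/-- `N^i_{n,j}`, the number of those rounds in which the challenger `j` was pulled. -/
def challengerPulls (B C I : ℕ → Ω → Fin K) (n : ℕ) (i j : Fin K) (ω : Ω) : ℕ :=
  ((Finset.Ioo K n).filter (fun t => (B t ω = i ∧ C t ω = j) ∧ I t ω = j)).card

/-- The history `F_n` before time `n`, generated by `(I_t, X_t)` for `1 ≤ t < n`. -/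
def history [mΩ : MeasurableSpace Ω] (I : ℕ → Ω → Fin K) (X : ℕ → Ω → ℝ)
    (hI : ∀ n, Measurable (I n)) (hX : ∀ n, Measurable (X n)) : Filtration ℕ mΩ where
  seq n := ⨆ t ∈ Finset.Ico 1 n,
    MeasurableSpace.comap (fun ω => (I t ω, X t ω)) inferInstance
  mono' := fun _ _ h => biSup_mono (fun _ ht =>
    Finset.mem_Ico.2 ⟨(Finset.mem_Ico.1 ht).1, (Finset.mem_Ico.1 ht).2.trans_le h⟩)
  le' := fun _ => iSup₂_le (fun t _ => ((hI t).prodMk (hX t)).comap_le)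

/-- The processes `ihat` (recommendation, which is also the leader), `C` (challenger), `I`
(pulled arm) and `X` (observed reward) are a run on the probability space `(Ω, P)` of the
algorithm EB-TC with slack `ε₀` and fixed proportion `β` on the bandit instance `ν`.
Ties in the two optimizations are broken arbitrarily. -/
structure IsEBTCRun [mΩ : MeasurableSpace Ω] (P : Measure Ω) (ν : Fin K → Measure ℝ) (ε₀ β : ℝ)
    (ihat C I : ℕ → Ω → Fin K) (X : ℕ → Ω → ℝ) : Prop where
  measurable_ihat : ∀ n, Measurable (ihat n)
  measurable_challenger : ∀ n, Measurable (C n)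
  measurable_arm : ∀ n, Measurable (I n)
  measurable_reward : ∀ n, Measurable (X n)
  /-- Given the history before time `n` and the pulled arm `I_n`, the reward has law `ν_{I_n}`. -/
  reward_law : ∀ n, 1 ≤ n → ∀ s : Set ℝ, MeasurableSet s →
    P⟦X n ⁻¹' s | (history I X measurable_arm measurable_reward n ⊔
        MeasurableSpace.comap (I n) inferInstance : MeasurableSpace Ω)⟧
      =ᵐ[P] fun ω => (ν (I n ω)).real s
  /-- During the first `K` rounds each arm is pulled once. -/
  init : ∀ ω k, ∃ t ∈ Finset.Icc 1 K, I t ω = k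
  /-- The recommendation is an empirical best arm. -/
  ihat_max : ∀ ω n, K < n → ∀ k, empMean I X n k ω ≤ empMean I X n (ihat n ω) ω
  challenger_ne : ∀ ω n, K < n → C n ω ≠ ihat n ω
  /-- The challenger minimizes the transportation cost. -/
  challenger_min : ∀ ω n, K < n → ∀ k, k ≠ ihat n ω →
    transportCost ε₀ I X n (ihat n ω) (C n ω) ω ≤ transportCost ε₀ I X n (ihat n ω) k ω
  /-- Tracking, with one procedure for each pair of leader and challenger. -/
  pull_challenger : ∀ ω n, K < n →
    (challengerPulls ihat C I n (ihat n ω) (C n ω) ω : ℝ) ≤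
      (1 - β) * (pairCount ihat C (n + 1) (ihat n ω) (C n ω) ω : ℝ) →
    I n ω = C n ω
  pull_leader : ∀ ω n, K < n →
    (1 - β) * (pairCount ihat C (n + 1) (ihat n ω) (C n ω) ω : ℝ) <
      (challengerPulls ihat C I n (ihat n ω) (C n ω) ω : ℝ) →
    I n ω = ihat n ω

/-- The `(ε, δ)`-unverifiable sample complexity: the least expectation (an infimum) of a stopping
time `τ` of the filtration `F` such that, with probability at least `1 - δ`, all recommendations
from `τ` on are `ε`-good. As recommendations start after time `K`, `τ > K` is required. -/
noncomputable def unverifiableSampleComplexity [mΩ : MeasurableSpace Ω] (P : Measure Ω)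
    (F : Filtration ℕ mΩ) (μ : Fin K → ℝ) (ihat : ℕ → Ω → Fin K) (ε δ : ℝ) : ℝ≥0∞ :=
  ⨅ τ ∈ {τ : Ω → ℕ∞ | IsStoppingTime F τ ∧ (∀ ω, (K : ℕ∞) < τ ω) ∧
      ENNReal.ofReal (1 - δ) ≤ P {ω | ∀ n : ℕ, τ ω ≤ (n : ℕ∞) → ihat n ω ∈ goodArms μ ε}},
    ∫⁻ ω, ((τ ω : ℕ∞) : ℝ≥0∞) ∂P

end Algorithm

/-! Let T = ⌊U⌋₊ + 1 and let f be `confidenceLevel` at T. If every arm is ε-good there is nothing to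
prove, so let i < C_μ. With probability at least 1 - δ the empirical means concentrate at level f
(`IsConcentrated`), and on that event the argument is deterministic.

Concentration rests on one exponential supermartingale, whose parameter depends only on the arm and
on its number of earlier pulls. Setting the parameter to 0 after a given number of pulls freezes the
weight, so the union bounds run over pull counts instead of times. Differences of two means are
controlled up to T only; single means are controlled at all times, by a geometric series in the pull
count. This is what allows a statement about all n ≥ T.

Fix the j attaining the minimum in H_i. A leader of class above j occurs only while leader or
challenger is undersampled (`pulls_le_or_pulls_le`), and tracking with β = 1/2 limits such rounds:
an arm is leader or challenger at most about twice as often as it is pulled. The part `hTilde` of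
H_i then yields an arm k₀ of class at most j pulled often before T (`exists_mem_pulls_ge`). The part
`hBar` yields a round t < T whose leader and challenger are both well sampled (`exists_pulls_gt`).
The leader at t has class at most j, and since the challenger minimizes a cost with numerator at
least ε₀, every arm of class above i is well sampled at t too (`le_pulls_mul`). From T on, the
empirical means of these arms stay below μ⋆ - (Δ_{i+1} + Δ_j)/2 and that of k₀ stays above it, so
none of them is recommended (`gapIndex_ihat_le`).

All this requires T > 8 H_i f + 5K²/2, where f itself contains 2 log T; `lt_of_hTwo_lt` solves this
inequality through the Lambert function. The sample complexity bound uses the constant stopping time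
T, and the asymptotics follow from y = x + log y for y = `lambertWBar` x. -/

/-! ### Exponential weights along a run -/

section Weights

variable {Ω : Type*} {K : ℕ}

/-- The logarithm of the exponential weight before time `n`, when the pull of the arm `k` after `m`
earlier pulls of `k` has the parameter `g k m`. -/
noncomputable def logWeight (μ : Fin K → ℝ) (g : Fin K → ℕ → ℝ) (I : ℕ → Ω → Fin K)
    (X : ℕ → Ω → ℝ) (n : ℕ) (ω : Ω) : ℝ :=
  ∑ t ∈ Finset.Ico 1 n, (g (I t ω) (pulls I t (I t ω) ω) * (X t ω - μ (I t ω))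
    - g (I t ω) (pulls I t (I t ω) ω) ^ 2 / 2)

theorem pulls_succ (I : ℕ → Ω → Fin K) {n : ℕ} (hn : 1 ≤ n) (k : Fin K) (ω : Ω) :
    pulls I (n + 1) k ω = pulls I n k ω + if I n ω = k then 1 else 0 := by
  rw [pulls, pulls, Finset.card_filter, Finset.card_filter, Finset.sum_Ico_succ_top hn]

theorem measurable_pulls {m : MeasurableSpace Ω} {I : ℕ → Ω → Fin K} (n : ℕ)
    (hI : ∀ t ∈ Finset.Ico 1 n, Measurable[m] (I t)) (k : Fin K) :
    Measurable[m] (pulls I n k) := by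
  have : pulls I n k = fun ω => ∑ t ∈ Finset.Ico 1 n, if I t ω = k then 1 else 0 := by
    ext ω; rw [pulls, Finset.card_filter]
  rw [this]
  exact Finset.measurable_sum _ fun t ht =>
    Measurable.ite (hI t ht (measurableSet_singleton k)) measurable_const measurable_const

theorem measurable_comp_pulls {m : MeasurableSpace Ω} {I : ℕ → Ω → Fin K} (n : ℕ)
    (hI : ∀ t ∈ Finset.Ico 1 (n + 1), Measurable[m] (I t)) (hn : 1 ≤ n) (g : Fin K → ℕ → ℝ) :
    Measurable[m] (fun ω => g (I n ω) (pulls I n (I n ω) ω)) := by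
  have : (fun ω => g (I n ω) (pulls I n (I n ω) ω))
      = fun ω => ∑ k, if I n ω = k then g k (pulls I n k ω) else 0 := by
    ext ω; simp
  rw [this]
  refine Finset.measurable_sum _ fun k _ => Measurable.ite
    (hI n (by simp [hn]) (measurableSet_singleton k)) ?_ measurable_const
  exact (measurable_from_nat (f := g k)).comp
    (measurable_pulls n (fun t ht => hI t (by simp at ht ⊢; omega)) k)

theorem measurable_logWeight {m : MeasurableSpace Ω} {I : ℕ → Ω → Fin K} {X : ℕ → Ω → ℝ} (n : ℕ)
    (hI : ∀ t ∈ Finset.Ico 1 n, Measurable[m] (I t))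
    (hX : ∀ t ∈ Finset.Ico 1 n, Measurable[m] (X t)) (μ : Fin K → ℝ) (g : Fin K → ℕ → ℝ) :
    Measurable[m] (logWeight μ g I X n) := by
  refine Finset.measurable_sum _ fun t ht => ?_
  have hg := measurable_comp_pulls (m := m) t
    (fun s hs => hI s (by simp at hs ht ⊢; omega)) (Finset.mem_Ico.1 ht).1 g
  exact (hg.mul ((hX t ht).sub ((measurable_of_finite μ).comp (hI t ht)))).sub
    ((hg.pow_const 2).div_const 2)

theorem lintegral_exp_le_one {ρ : Measure ℝ} (h : IsOneSubGaussian ρ) (l : ℝ) :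
    ∫⁻ x, ENNReal.ofReal (Real.exp (l * (x - ∫ y, y ∂ρ) - l ^ 2 / 2)) ∂ρ ≤ 1 := by
  have h1 := h.integrable_exp_mul l
  have h2 := h.mgf_le l
  have e : ∀ x : ℝ, Real.exp (l * (x - ∫ y, y ∂ρ) - l ^ 2 / 2)
      = Real.exp (l * (x - ∫ y, y ∂ρ)) * Real.exp (- (l ^ 2 / 2)) := fun x => by
    rw [← Real.exp_add, sub_eq_add_neg]
  simp_rw [e]
  rw [← ofReal_integral_eq_lintegral_ofReal (h1.mul_const _)
    (Eventually.of_forall fun x => by positivity), ENNReal.ofReal_le_one, integral_mul_const]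
  calc _ ≤ Real.exp ((1 : ℝ≥0) * l ^ 2 / 2) * Real.exp (- (l ^ 2 / 2)) :=
        mul_le_mul_of_nonneg_right h2 (Real.exp_pos _).le
    _ = 1 := by rw [← Real.exp_add]; simp

/-- The sum of the first rewards of an arm, seen as a part of the exponential weight. -/
theorem sum_ite_pulls_lt (I : ℕ → Ω → Fin K) (X : ℕ → Ω → ℝ) (Y : Fin K → ℝ → ℝ) (ω : Ω)
    (k : Fin K) {t T : ℕ} (ht : t ≤ T) :
    ∑ s ∈ Finset.Ico 1 T, (if I s ω = k ∧ pulls I s k ω < pulls I t k ω then Y k (X s ω) else 0)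
      = ∑ s ∈ (Finset.Ico 1 t).filter (fun s => I s ω = k), Y k (X s ω) := by
  rw [← Finset.sum_filter]
  congr 1
  ext s
  simp only [Finset.mem_filter, Finset.mem_Ico]
  constructor
  · rintro ⟨⟨h1, h2⟩, h3, h4⟩
    refine ⟨⟨h1, lt_of_not_ge fun hc => ?_⟩, h3⟩
    exact absurd (Finset.card_le_card (Finset.filter_subset_filter (fun u => I u ω = k)
      (Finset.Ico_subset_Ico_right (a := 1) hc))) (not_le.2 h4)
  · rintro ⟨⟨h1, h2⟩, h3⟩
    refine ⟨⟨h1, h2.trans_le ht⟩, h3, ?_⟩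
    have : pulls I (s + 1) k ω ≤ pulls I t k ω :=
      Finset.card_le_card (Finset.filter_subset_filter _
        (Finset.Ico_subset_Ico_right (by omega)))
    rw [pulls_succ I h1, if_pos h3] at this
    omega

theorem sum_pulls_eq (I : ℕ → Ω → Fin K) (X : ℕ → Ω → ℝ) (ω : Ω) (t : ℕ) (k : Fin K) (m l : ℝ)
    (hp : pulls I t k ω ≠ 0) :
    ∑ s ∈ (Finset.Ico 1 t).filter (fun s => I s ω = k), (l * (X s ω - m) - l ^ 2 / 2)
      = pulls I t k ω * (l * (empMean I X t k ω - m) - l ^ 2 / 2) := by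
  have hp' : (pulls I t k ω : ℝ) ≠ 0 := by exact_mod_cast hp
  have hc : ((Finset.Ico 1 t).filter (fun s => I s ω = k)).card = pulls I t k ω := rfl
  rw [Finset.sum_sub_distrib, ← Finset.mul_sum, Finset.sum_sub_distrib, Finset.sum_const,
    Finset.sum_const, hc, empMean]
  simp only [nsmul_eq_mul]
  field_simp

variable [mΩ : MeasurableSpace Ω] {P : Measure Ω} [IsProbabilityMeasure P]
  {ν : Fin K → Measure ℝ} {ε₀ β : ℝ} {ihat C I : ℕ → Ω → Fin K} {X : ℕ → Ω → ℝ}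

theorem comap_le_history (hI : ∀ n, Measurable (I n)) (hX : ∀ n, Measurable (X n)) {n t : ℕ}
    (ht : t ∈ Finset.Ico 1 n) :
    MeasurableSpace.comap (fun ω => (I t ω, X t ω)) inferInstance ≤ history I X hI hX n :=
  le_iSup₂_of_le (f := fun t (_ : t ∈ Finset.Ico 1 n) =>
    MeasurableSpace.comap (fun ω => (I t ω, X t ω)) inferInstance) t ht le_rfl

theorem measurable_arm_history (hI : ∀ n, Measurable (I n)) (hX : ∀ n, Measurable (X n)) {n t : ℕ}
    (ht : t ∈ Finset.Ico 1 n) : Measurable[history I X hI hX n] (I t) :=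
  measurable_fst.comp (measurable_iff_comap_le.2 (comap_le_history hI hX ht))

theorem measurable_reward_history (hI : ∀ n, Measurable (I n)) (hX : ∀ n, Measurable (X n))
    {n t : ℕ} (ht : t ∈ Finset.Ico 1 n) : Measurable[history I X hI hX n] (X t) :=
  measurable_snd.comp (measurable_iff_comap_le.2 (comap_le_history hI hX ht))

/-- The joint law of the history (through a statistic `Y`) and the next reward, on the event
that the arm `k` is pulled. -/
theorem IsEBTCRun.map_restrict_eq (h : IsEBTCRun P ν ε₀ β ihat C I X)
    (hprob : ∀ k, IsProbabilityMeasure (ν k)) {n : ℕ} (hn : 1 ≤ n) (k : Fin K)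
    {E : Type*} [MeasurableSpace E] {Y : Ω → E}
    (hY : Measurable[history I X h.measurable_arm h.measurable_reward n] Y) :
    (P.restrict (I n ⁻¹' {k})).map (fun ω => (Y ω, X n ω))
      = ((P.restrict (I n ⁻¹' {k})).map Y).prod (ν k) := by
  have hYm : Measurable Y := hY.mono ((history I X _ _).le n) le_rfl
  symm
  refine Measure.prod_eq fun s t hs ht => ?_
  have hle : (history I X h.measurable_arm h.measurable_reward n ⊔
      MeasurableSpace.comap (I n) inferInstance : MeasurableSpace Ω) ≤ mΩ :=
    sup_le ((history I X _ _).le n) (h.measurable_arm n).comap_le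
  have hA : MeasurableSet[(history I X h.measurable_arm h.measurable_reward n ⊔
      MeasurableSpace.comap (I n) inferInstance : MeasurableSpace Ω)]
      (Y ⁻¹' s ∩ I n ⁻¹' {k}) :=
    MeasurableSet.inter
      ((le_sup_left : _ ≤ (history I X h.measurable_arm h.measurable_reward n ⊔
        MeasurableSpace.comap (I n) inferInstance : MeasurableSpace Ω)) _ (hY hs))
      ((le_sup_right : _ ≤ (history I X h.measurable_arm h.measurable_reward n ⊔
        MeasurableSpace.comap (I n) inferInstance : MeasurableSpace Ω)) _
        ⟨{k}, measurableSet_singleton k, rfl⟩)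
  have hXt : MeasurableSet (X n ⁻¹' t) := h.measurable_reward n ht
  -- The event belongs to the conditioning σ-algebra, so integrating `reward_law` over it gives the
  -- product formula on rectangles.
  have h1 := setIntegral_condExp hle
    ((integrable_const (1 : ℝ)).indicator hXt : Integrable ((X n ⁻¹' t).indicator fun _ => (1 : ℝ)) P)
    hA
  have h2 : ∫ ω in Y ⁻¹' s ∩ I n ⁻¹' {k}, (ν (I n ω)).real t ∂P
      = ∫ ω in Y ⁻¹' s ∩ I n ⁻¹' {k}, (X n ⁻¹' t).indicator (fun _ => (1 : ℝ)) ω ∂P := by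
    rw [← h1]
    exact integral_congr_ae (ae_restrict_of_ae (h.reward_law n hn t ht).symm)
  rw [setIntegral_congr_fun (g := fun _ => (ν k).real t) (hle _ hA)
      (fun ω hω => by rw [show I n ω = k from hω.2]), setIntegral_const,
    integral_indicator hXt, setIntegral_const, measureReal_restrict_apply hXt] at h2
  rw [Measure.map_apply (hYm.prodMk (h.measurable_reward n)) (hs.prod ht),
    Measure.map_apply hYm hs,
    Measure.restrict_apply ((hYm.prodMk (h.measurable_reward n)) (hs.prod ht)),
    Measure.restrict_apply (hYm hs)]
  have e : (fun ω => (Y ω, X n ω)) ⁻¹' s ×ˢ t ∩ I n ⁻¹' {k}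
      = X n ⁻¹' t ∩ (Y ⁻¹' s ∩ I n ⁻¹' {k}) := by
    ext ω; simp; tauto
  rw [e, ← ENNReal.toReal_eq_toReal_iff' (by finiteness) (by finiteness), ENNReal.toReal_mul]
  simpa [Measure.real] using h2.symm

/-- Supermartingale property: given the past and the pulled arm, the parameter of the next factor is
known, so sub-Gaussianity bounds the conditional mean of that factor by 1. -/
theorem IsEBTCRun.lintegral_exp_logWeight_le (h : IsEBTCRun P ν ε₀ β ihat C I X)
    (hprob : ∀ k, IsProbabilityMeasure (ν k)) (hsub : ∀ k, IsOneSubGaussian (ν k))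
    (g : Fin K → ℕ → ℝ) (n : ℕ) :
    ∫⁻ ω, ENNReal.ofReal (Real.exp (logWeight (armMean ν) g I X n ω)) ∂P ≤ 1 := by
  induction n with
  | zero => simp [logWeight]
  | succ n ih =>
    rcases Nat.eq_zero_or_pos n with rfl | hn
    · simp [logWeight]
    refine le_trans ?_ ih
    -- On each event I_n = k the next reward has the fixed law ν k, independently of the past, so
    -- the arms are treated separately.
    have hcover : (⋃ k : Fin K, I n ⁻¹' {k}) = Set.univ := by ext; simp
    have hdisj : Pairwise (Function.onFun Disjoint fun k : Fin K => I n ⁻¹' {k}) := by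
      intro a b hab
      exact Disjoint.preimage _ (by simpa using hab)
    rw [← setLIntegral_univ, ← setLIntegral_univ (μ := P), ← hcover,
      lintegral_iUnion (fun k => h.measurable_arm n (measurableSet_singleton k)) hdisj,
      lintegral_iUnion (fun k => h.measurable_arm n (measurableSet_singleton k)) hdisj]
    refine ENNReal.tsum_le_tsum fun k => ?_
    set G := history I X h.measurable_arm h.measurable_reward with hGdef
    have hW : Measurable[G n] (logWeight (armMean ν) g I X n) :=
      measurable_logWeight n
        (fun t ht => measurable_arm_history h.measurable_arm h.measurable_reward ht)
        (fun t ht => measurable_reward_history h.measurable_arm h.measurable_reward ht) _ g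
    have hN : Measurable[G n] (pulls I n k) :=
      measurable_pulls n
        (fun t ht => measurable_arm_history h.measurable_arm h.measurable_reward ht) k
    -- The statistic of the past must carry the pull count, which selects the parameter g k.
    have hY : Measurable[G n] (fun ω => (logWeight (armMean ν) g I X n ω, pulls I n k ω)) :=
      hW.prodMk hN
    have hYm : Measurable (fun ω => (logWeight (armMean ν) g I X n ω, pulls I n k ω)) :=
      hY.mono (G.le n) le_rfl
    let F : (ℝ × ℕ) × ℝ → ℝ≥0∞ := fun p => ENNReal.ofReal (Real.exp p.1.1) *
      ENNReal.ofReal (Real.exp (g k p.1.2 * (p.2 - armMean ν k) - g k p.1.2 ^ 2 / 2))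
    have hgm : Measurable (fun p : (ℝ × ℕ) × ℝ => g k p.1.2) :=
      (measurable_from_nat (f := g k)).comp (by fun_prop)
    have hF : Measurable F := by
      refine Measurable.mul (f := fun p : (ℝ × ℕ) × ℝ => ENNReal.ofReal (Real.exp p.1.1)) ?_ ?_
      · fun_prop
      · exact (Real.measurable_exp.comp (((hgm.mul (measurable_snd.sub_const _))).sub
          ((hgm.pow_const 2).div_const 2))).ennreal_ofReal
    have e1 : ∫⁻ ω in I n ⁻¹' {k},
          ENNReal.ofReal (Real.exp (logWeight (armMean ν) g I X (n + 1) ω)) ∂P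
        = ∫⁻ p, F p ∂((P.restrict (I n ⁻¹' {k})).map
            (fun ω => ((logWeight (armMean ν) g I X n ω, pulls I n k ω), X n ω))) := by
      rw [lintegral_map hF (hYm.prodMk (h.measurable_reward n))]
      refine setLIntegral_congr_fun (h.measurable_arm n (measurableSet_singleton k)) ?_
      intro ω hω
      have hω' : I n ω = k := hω
      simp only [F, logWeight]
      rw [Finset.sum_Ico_succ_top hn, Real.exp_add, ENNReal.ofReal_mul (Real.exp_pos _).le, hω']
    rw [e1, h.map_restrict_eq hprob hn k hY, lintegral_prod _ hF.aemeasurable,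
      lintegral_map hF.lintegral_prod_right' hYm]
    refine lintegral_mono fun ω => ?_
    simp only [F]
    rw [lintegral_const_mul']
    · exact mul_le_of_le_one_right' (lintegral_exp_le_one (hsub k) _)
    · exact ENNReal.ofReal_ne_top

theorem IsEBTCRun.measure_le_logWeight (h : IsEBTCRun P ν ε₀ β ihat C I X)
    (hprob : ∀ k, IsProbabilityMeasure (ν k)) (hsub : ∀ k, IsOneSubGaussian (ν k))
    (g : Fin K → ℕ → ℝ) (n : ℕ) (f : ℝ) :
    P {ω | f ≤ logWeight (armMean ν) g I X n ω} ≤ ENNReal.ofReal (Real.exp (-f)) := by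
  have hm : Measurable (logWeight (armMean ν) g I X n) :=
    measurable_logWeight n (fun t _ => h.measurable_arm t) (fun t _ => h.measurable_reward t) _ g
  have h1 := mul_meas_ge_le_lintegral (μ := P)
    (f := fun ω => ENNReal.ofReal (Real.exp (logWeight (armMean ν) g I X n ω)))
    (Real.measurable_exp.comp hm).ennreal_ofReal (ENNReal.ofReal (Real.exp f))
  have h2 := h1.trans (h.lintegral_exp_logWeight_le hprob hsub g n)
  have e : {ω | ENNReal.ofReal (Real.exp f)
      ≤ ENNReal.ofReal (Real.exp (logWeight (armMean ν) g I X n ω))}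
      = {ω | f ≤ logWeight (armMean ν) g I X n ω} := by
    ext ω
    simp only [Set.mem_ofPred_eq]
    rw [ENNReal.ofReal_le_ofReal_iff (Real.exp_pos _).le, Real.exp_le_exp]
  rw [e] at h2
  calc P {ω | f ≤ logWeight (armMean ν) g I X n ω}
      = ENNReal.ofReal (Real.exp (-f)) * (ENNReal.ofReal (Real.exp f)
          * P {ω | f ≤ logWeight (armMean ν) g I X n ω}) := by
        rw [← mul_assoc, ← ENNReal.ofReal_mul (Real.exp_pos _).le, ← Real.exp_add]
        simp
    _ ≤ ENNReal.ofReal (Real.exp (-f)) * 1 := by gcongr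
    _ = _ := mul_one _

/-- Deviation of the difference of two empirical means, for given numbers of pulls. -/
theorem IsEBTCRun.measure_pair_le (h : IsEBTCRun P ν ε₀ β ihat C I X)
    (hprob : ∀ k, IsProbabilityMeasure (ν k)) (hsub : ∀ k, IsOneSubGaussian (ν k))
    {i j : Fin K} (hij : i ≠ j) {a b : ℕ} (ha : 1 ≤ a) (hb : 1 ≤ b) (T : ℕ) {f : ℝ}
    (hf : 0 ≤ f) :
    P {ω | ∃ t ≤ T, pulls I t i ω = a ∧ pulls I t j ω = b ∧
        Real.sqrt (2 * f) * Real.sqrt (1 / (a : ℝ) + 1 / (b : ℝ)) ≤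
          (empMean I X t i ω - armMean ν i) - (empMean I X t j ω - armMean ν j)}
      ≤ ENNReal.ofReal (Real.exp (-f)) := by
  have ha' : (0 : ℝ) < a := by exact_mod_cast ha
  have hb' : (0 : ℝ) < b := by exact_mod_cast hb
  set s := Real.sqrt (1 / (a : ℝ) + 1 / (b : ℝ)) with hs
  have hspos : 0 < s := Real.sqrt_pos.2 (by positivity)
  have hs2 : s ^ 2 = 1 / (a : ℝ) + 1 / (b : ℝ) := Real.sq_sqrt (by positivity)
  have hf2 : Real.sqrt (2 * f) ^ 2 = 2 * f := Real.sq_sqrt (by positivity)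
  -- The maximizer of c x - c² s² / 2 at the deviation x = √(2f) s, where the maximum is f.
  set c := Real.sqrt (2 * f) / s with hc
  have hc0 : 0 ≤ c := by positivity
  have hcs : c * s = Real.sqrt (2 * f) := div_mul_cancel₀ _ hspos.ne'
  -- Only the first a pulls of i and the first b pulls of j count. The weight at T thus equals its
  -- value at any t ≤ T with these pull counts, and no union over t is needed.
  let g : Fin K → ℕ → ℝ := fun k m =>
    if k = i ∧ m < a then c / a else if k = j ∧ m < b then -(c / b) else 0
  refine le_trans (measure_mono ?_) (h.measure_le_logWeight hprob hsub g T f)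
  rintro ω ⟨t, ht, hai, hbj, hdev⟩
  have e : logWeight (armMean ν) g I X T ω
      = a * (c / a * (empMean I X t i ω - armMean ν i) - (c / a) ^ 2 / 2)
        + b * (-(c / b) * (empMean I X t j ω - armMean ν j) - (-(c / b)) ^ 2 / 2) := by
    have e1 := sum_ite_pulls_lt I X
      (fun k x => c / a * (x - armMean ν k) - (c / a) ^ 2 / 2) ω i ht
    have e2 := sum_ite_pulls_lt I X
      (fun k x => -(c / b) * (x - armMean ν k) - (-(c / b)) ^ 2 / 2) ω j ht
    rw [sum_pulls_eq I X ω t i _ _ (by omega)] at e1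
    rw [sum_pulls_eq I X ω t j _ _ (by omega)] at e2
    rw [hai] at e1
    rw [hbj] at e2
    rw [← e1, ← e2, logWeight, ← Finset.sum_add_distrib]
    refine Finset.sum_congr rfl fun s _ => ?_
    by_cases hi : I s ω = i
    · simp only [g, hi, hij, true_and, false_and, if_false]
      split_ifs <;> simp
    · by_cases hj : I s ω = j
      · simp only [g, hj, hij.symm, true_and, false_and, if_false]
        split_ifs <;> simp
      · simp [g, hi, hj]
  rw [Set.mem_ofPred_eq, e]
  have e3 : a * (c / a * (empMean I X t i ω - armMean ν i) - (c / a) ^ 2 / 2)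
        + b * (-(c / b) * (empMean I X t j ω - armMean ν j) - (-(c / b)) ^ 2 / 2)
      = c * ((empMean I X t i ω - armMean ν i) - (empMean I X t j ω - armMean ν j))
        - c ^ 2 * (1 / (a : ℝ) + 1 / (b : ℝ)) / 2 := by
    field_simp
    ring
  have h1 := mul_le_mul_of_nonneg_left hdev hc0
  have h2 : c * (Real.sqrt (2 * f) * s) = 2 * f := by
    rw [← mul_assoc, mul_right_comm, hcs, ← sq, hf2]
  have h3 : c ^ 2 * s ^ 2 = 2 * f := by rw [← mul_pow, hcs, hf2]
  rw [e3, ← hs2]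
  linarith

/-- Deviation of an empirical mean from the mean, in the direction `σ = ± 1`, for a given number
of pulls. -/
theorem IsEBTCRun.measure_single_le (h : IsEBTCRun P ν ε₀ β ihat C I X)
    (hprob : ∀ k, IsProbabilityMeasure (ν k)) (hsub : ∀ k, IsOneSubGaussian (ν k))
    (k : Fin K) {σ : ℝ} (hσ : σ ^ 2 = 1) {a : ℕ} (ha : 1 ≤ a) {y : ℝ} (hy : 0 ≤ y) :
    P {ω | ∃ t, pulls I t k ω = a ∧ y ≤ σ * (empMean I X t k ω - armMean ν k)}
      ≤ ENNReal.ofReal (Real.exp (-(a * y ^ 2 / 2))) := by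
  -- The bound is uniform in the horizon T, so it passes to the increasing union over all horizons.
  have hmono : Monotone fun T : ℕ =>
      {ω | ∃ t ≤ T, pulls I t k ω = a ∧ y ≤ σ * (empMean I X t k ω - armMean ν k)} :=
    fun T T' hT ω ⟨t, ht, h⟩ => ⟨t, ht.trans hT, h⟩
  have e0 : {ω | ∃ t, pulls I t k ω = a ∧ y ≤ σ * (empMean I X t k ω - armMean ν k)}
      = ⋃ T : ℕ, {ω | ∃ t ≤ T, pulls I t k ω = a ∧
          y ≤ σ * (empMean I X t k ω - armMean ν k)} := by
    ext ω
    simp only [Set.mem_ofPred_eq, Set.mem_iUnion]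
    exact ⟨fun ⟨t, h⟩ => ⟨t, t, le_rfl, h⟩, fun ⟨_, t, _, h⟩ => ⟨t, h⟩⟩
  rw [e0, hmono.measure_iUnion]
  refine iSup_le fun T => ?_
  let g : Fin K → ℕ → ℝ := fun k' m => if k' = k ∧ m < a then σ * y else 0
  refine le_trans (measure_mono ?_) (h.measure_le_logWeight hprob hsub g T _)
  rintro ω ⟨t, ht, hak, hdev⟩
  have e : logWeight (armMean ν) g I X T ω
      = a * (σ * y * (empMean I X t k ω - armMean ν k) - (σ * y) ^ 2 / 2) := by
    have e1 := sum_ite_pulls_lt I X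
      (fun k x => σ * y * (x - armMean ν k) - (σ * y) ^ 2 / 2) ω k ht
    rw [sum_pulls_eq I X ω t k _ _ (by omega), hak] at e1
    rw [← e1, logWeight]
    refine Finset.sum_congr rfl fun s _ => ?_
    by_cases hi : I s ω = k
    · simp only [g, hi, true_and]
      split_ifs <;> simp
    · simp [g, hi]
  rw [Set.mem_ofPred_eq, e, mul_pow, hσ, one_mul]
  have h1 : y * y ≤ σ * y * (empMean I X t k ω - armMean ν k) :=
    (mul_le_mul_of_nonneg_left hdev hy).trans_eq (by ring)
  have h2 : (0 : ℝ) ≤ a := a.cast_nonneg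
  nlinarith

/-- A geometric series of ratio e^{-c}; e^c ≥ 1 + c gives 1 / (1 - e^{-c}) ≤ 1 + 1/c. -/
theorem tsum_exp_le {c f : ℝ} (hc : 0 < c) {N : ℕ} (hN : f ≤ N * c) :
    ∑' m : ℕ, ENNReal.ofReal (Real.exp (-((N + m : ℕ) * c)))
      ≤ ENNReal.ofReal ((1 + 1 / c) * Real.exp (-f)) := by
  have hr : Real.exp (-c) < 1 := by rw [Real.exp_lt_one_iff]; linarith
  have e : ∀ m : ℕ, Real.exp (-((N + m : ℕ) * c)) = Real.exp (-(N * c)) * Real.exp (-c) ^ m := by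
    intro m
    rw [← Real.exp_nat_mul, ← Real.exp_add]
    push_cast
    congr 1
    ring
  simp_rw [e]
  have hs : Summable fun m : ℕ => Real.exp (-(N * c)) * Real.exp (-c) ^ m :=
    (summable_geometric_of_lt_one (Real.exp_pos _).le hr).mul_left _
  rw [← ENNReal.ofReal_tsum_of_nonneg (fun m => by positivity) hs]
  apply ENNReal.ofReal_le_ofReal
  rw [tsum_mul_left, tsum_geometric_of_lt_one (Real.exp_pos _).le hr, mul_comm]
  have h1 : (1 - Real.exp (-c))⁻¹ ≤ 1 + 1 / c := by
    rw [inv_le_comm₀ (by linarith) (by positivity)]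
    have h2 : Real.exp (-c) ≤ 1 / (1 + c) := by
      rw [Real.exp_neg, ← one_div]
      exact one_div_le_one_div_of_le (by linarith) (by linarith [Real.add_one_le_exp c])
    have h3 : (1 + 1 / c)⁻¹ = 1 - 1 / (1 + c) := by
      field_simp
      ring
    linarith
  have h2 : Real.exp (-(N * c)) ≤ Real.exp (-f) := Real.exp_le_exp.2 (by linarith)
  exact mul_le_mul h1 h2 (Real.exp_pos _).le (by positivity)

/-- Deviation of an empirical mean by `y`, for all large numbers of pulls. -/
theorem IsEBTCRun.measure_single_forall_le (h : IsEBTCRun P ν ε₀ β ihat C I X)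
    (hprob : ∀ k, IsProbabilityMeasure (ν k)) (hsub : ∀ k, IsOneSubGaussian (ν k))
    (k : Fin K) {σ : ℝ} (hσ : σ ^ 2 = 1) {y f : ℝ} (hy : 0 < y) (hf : 0 < f) :
    P {ω | ∃ t, f ≤ pulls I t k ω * (y ^ 2 / 2) ∧ y ≤ σ * (empMean I X t k ω - armMean ν k)}
      ≤ ENNReal.ofReal ((1 + 1 / (y ^ 2 / 2)) * Real.exp (-f)) := by
  have hc : 0 < y ^ 2 / 2 := by positivity
  set c := y ^ 2 / 2 with hcdef
  -- The least pull count covered by the event; the union is over the counts N + m.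
  set N := ⌈f / c⌉₊ with hN
  have hN1 : 1 ≤ N := Nat.one_le_ceil_iff.2 (by positivity)
  refine le_trans (measure_mono (t := ⋃ m : ℕ,
    {ω | ∃ t, pulls I t k ω = N + m ∧ y ≤ σ * (empMean I X t k ω - armMean ν k)}) ?_) ?_
  · rintro ω ⟨t, h1, h2⟩
    have h3 : N ≤ pulls I t k ω := Nat.ceil_le.2 ((div_le_iff₀ hc).2 h1)
    exact Set.mem_iUnion.2 ⟨pulls I t k ω - N, t, by omega, h2⟩
  · refine (measure_iUnion_le _).trans (le_trans (ENNReal.tsum_le_tsum fun m => ?_)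
      (tsum_exp_le hc (N := N) ((div_le_iff₀ hc).1 (Nat.le_ceil _))))
    have := h.measure_single_le hprob hsub k hσ (a := N + m) (by omega) hy.le
    rwa [mul_div_assoc] at this

end Weights

/-! ### Counting rounds -/

section Counting

variable {Ω : Type*} {K : ℕ}

/-- The number of rounds before time `n`, after the initialization, with leader `k`. -/
def leadCount (B : ℕ → Ω → Fin K) (n : ℕ) (k : Fin K) (ω : Ω) : ℕ :=
  ((Finset.Ioo K n).filter (fun t => B t ω = k)).card

theorem filter_Ioo_succ_card (p : ℕ → Prop) [DecidablePred p] {n : ℕ} (h : K < n) :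
    ((Finset.Ioo K (n + 1)).filter p).card
      = ((Finset.Ioo K n).filter p).card + if p n then 1 else 0 := by
  have e : Finset.Ioo K (n + 1) = insert n (Finset.Ioo K n) := by
    ext x; simp only [Finset.mem_Ioo, Finset.mem_insert]; omega
  rw [e, Finset.filter_insert]
  split_ifs with hp
  · rw [Finset.card_insert_of_notMem (by simp)]
  · simp

/-- Tracking is deterministic for each pair: the challenger is pulled in the first two rounds of the
pair, then leader and challenger alternate. The pair count on the right of the rule includes the
current round. -/
theorem challengerPulls_eq {B C I : ℕ → Ω → Fin K} {ω : Ω}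
    (hne : ∀ n, K < n → C n ω ≠ B n ω)
    (hC : ∀ n, K < n →
      (challengerPulls B C I n (B n ω) (C n ω) ω : ℝ) ≤
        (1 - 1 / 2) * (pairCount B C (n + 1) (B n ω) (C n ω) ω : ℝ) → I n ω = C n ω)
    (hB : ∀ n, K < n →
      (1 - 1 / 2) * (pairCount B C (n + 1) (B n ω) (C n ω) ω : ℝ) <
        (challengerPulls B C I n (B n ω) (C n ω) ω : ℝ) → I n ω = B n ω)
    (n : ℕ) (i j : Fin K) :
    challengerPulls B C I n i j ω
      = if pairCount B C n i j ω = 0 then 0 else pairCount B C n i j ω / 2 + 1 := by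
  induction n with
  | zero => simp [challengerPulls, pairCount]
  | succ n ih =>
    rcases Nat.lt_or_ge K n with hn | hn
    · have e1 := filter_Ioo_succ_card (fun t => B t ω = i ∧ C t ω = j) hn
      have e2 := filter_Ioo_succ_card (fun t => (B t ω = i ∧ C t ω = j) ∧ I t ω = j) hn
      change pairCount B C (n + 1) i j ω = pairCount B C n i j ω + _ at e1
      change challengerPulls B C I (n + 1) i j ω = challengerPulls B C I n i j ω + _ at e2
      by_cases hp : B n ω = i ∧ C n ω = j
      · obtain ⟨rfl, rfl⟩ := hp
        have h1 := hC n hn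
        have h2 := hB n hn
        have h3 := hne n hn
        rw [if_pos ⟨rfl, rfl⟩] at e1
        generalize pairCount B C (n + 1) (B n ω) (C n ω) ω = T' at *
        generalize challengerPulls B C I (n + 1) (B n ω) (C n ω) ω = N' at *
        generalize pairCount B C n (B n ω) (C n ω) ω = T at *
        generalize challengerPulls B C I n (B n ω) (C n ω) ω = N at *
        by_cases hle : 2 * N ≤ T'
        · have : I n ω = C n ω := h1 (by
            have : (2 * N : ℝ) ≤ T' := by exact_mod_cast hle
            linarith)
          simp only [this, and_self, if_true] at e2
          split_ifs at ih ⊢ <;> omega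
        · have : I n ω = B n ω := h2 (by
            have : (T' : ℝ) < 2 * N := by exact_mod_cast not_le.1 hle
            linarith)
          simp only [this, h3.symm, and_false, if_false] at e2
          split_ifs at ih ⊢ <;> omega
      · have hp' : ¬ ((B n ω = i ∧ C n ω = j) ∧ I n ω = j) := fun h => hp h.1
        rw [if_neg hp] at e1
        rw [if_neg hp'] at e2
        rw [e1, e2]; simpa using ih
    · have : Finset.Ioo K (n + 1) = ∅ := by
        rw [← Finset.card_eq_zero, Nat.card_Ioo]; omega
      simp [challengerPulls, pairCount, this]

theorem sum_card_filter_and {s : Finset ℕ} (p : ℕ → Prop) [DecidablePred p] (f : ℕ → Fin K) :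
    ∑ j, (s.filter (fun t => p t ∧ f t = j)).card = (s.filter p).card := by
  rw [Finset.card_eq_sum_card_fiberwise (f := f) (t := Finset.univ) (by simp)]
  simp [Finset.filter_filter]

theorem one_add_card_filter_le_pulls {I : ℕ → Ω → Fin K} {ω : Ω}
    (hinit : ∀ k, ∃ t ∈ Finset.Icc 1 K, I t ω = k) {n : ℕ} (hn : K < n) (k : Fin K) :
    1 + ((Finset.Ioo K n).filter (fun t => I t ω = k)).card ≤ pulls I n k ω := by
  obtain ⟨t, ht, hk⟩ := hinit k
  rw [Finset.mem_Icc] at ht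
  rw [pulls, add_comm, ← Finset.card_insert_of_notMem (a := t)
    (by simp only [Finset.mem_filter, Finset.mem_Ioo]; omega)]
  apply Finset.card_le_card
  intro s hs
  simp only [Finset.mem_insert, Finset.mem_filter, Finset.mem_Ioo, Finset.mem_Ico] at hs ⊢
  rcases hs with rfl | hs
  · exact ⟨by omega, hk⟩
  · exact ⟨by omega, hs.2⟩

theorem pulls_mono (I : ℕ → Ω → Fin K) (k : Fin K) (ω : Ω) {m n : ℕ} (h : m ≤ n) :
    pulls I m k ω ≤ pulls I n k ω :=
  Finset.card_le_card (Finset.filter_subset_filter _ (Finset.Ico_subset_Ico_right h))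

theorem one_le_pulls {I : ℕ → Ω → Fin K} {ω : Ω}
    (hinit : ∀ k, ∃ t ∈ Finset.Icc 1 K, I t ω = k) {n : ℕ} (hn : K < n) (k : Fin K) :
    1 ≤ pulls I n k ω :=
  (Nat.le_add_right _ _).trans (one_add_card_filter_le_pulls hinit hn k)

/-! ### Consequences of tracking for the pull counts -/

variable [MeasurableSpace Ω] {P : Measure Ω} {ν : Fin K → Measure ℝ} {ε₀ : ℝ}
  {ihat C I : ℕ → Ω → Fin K} {X : ℕ → Ω → ℝ}

theorem IsEBTCRun.pairCount_le (h : IsEBTCRun P ν ε₀ (1 / 2) ihat C I X) (ω : Ω) (n : ℕ)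
    (i j : Fin K) :
    pairCount ihat C n i j ω ≤ 2 * challengerPulls ihat C I n i j ω ∧
    2 * challengerPulls ihat C I n i j ω ≤ pairCount ihat C n i j ω + 2 := by
  rw [challengerPulls_eq (h.challenger_ne ω) (h.pull_challenger ω) (h.pull_leader ω)]
  split_ifs <;> omega

theorem IsEBTCRun.pairCount_self (h : IsEBTCRun P ν ε₀ (1 / 2) ihat C I X) (ω : Ω) (n : ℕ)
    (i : Fin K) : pairCount ihat C n i i ω = 0 := by
  rw [pairCount, Finset.card_eq_zero, Finset.filter_eq_empty_iff]
  rintro t ht ⟨h1, h2⟩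
  exact h.challenger_ne ω t (Finset.mem_Ioo.1 ht).1 (h2.trans h1.symm)

/-- For each challenger the leader gets half of the rounds of the pair, up to an excess of one pull
for the challenger; these excesses are summed over the challengers. -/
theorem IsEBTCRun.leadCount_le (h : IsEBTCRun P ν ε₀ (1 / 2) ihat C I X) (ω : Ω) (n : ℕ)
    (k : Fin K) :
    leadCount ihat n k ω + 2 ≤
      2 * ((Finset.Ioo K n).filter (fun t => ihat t ω = k ∧ I t ω ≠ C t ω)).card + 2 * K := by
  have e1 : ∑ j, pairCount ihat C n k j ω = leadCount ihat n k ω :=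
    sum_card_filter_and (fun t => ihat t ω = k) (fun t => C t ω)
  have e2 : ∑ j, challengerPulls ihat C I n k j ω
      = ((Finset.Ioo K n).filter (fun t => ihat t ω = k ∧ I t ω = C t ω)).card := by
    rw [← sum_card_filter_and (fun t => ihat t ω = k ∧ I t ω = C t ω) (fun t => C t ω)]
    refine Finset.sum_congr rfl fun j _ => congrArg _ (Finset.filter_congr fun t _ => ?_)
    constructor
    · rintro ⟨⟨a, b⟩, c⟩; exact ⟨⟨a, c.trans b.symm⟩, b⟩
    · rintro ⟨⟨a, b⟩, c⟩; exact ⟨⟨a, c⟩, b.trans c⟩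
  have e3 : leadCount ihat n k ω
      = ((Finset.Ioo K n).filter (fun t => ihat t ω = k ∧ I t ω = C t ω)).card
        + ((Finset.Ioo K n).filter (fun t => ihat t ω = k ∧ I t ω ≠ C t ω)).card := by
    rw [leadCount, ← Finset.card_filter_add_card_filter_not (fun t => I t ω = C t ω)]
    simp [Finset.filter_filter]
  -- The index j = k is split off: it is never a challenger of k, so only K - 1 excesses occur.
  have e4 : ∑ j, 2 * challengerPulls ihat C I n k j ω + 2
      ≤ ∑ j, (pairCount ihat C n k j ω + 2) := by
    rw [← Finset.add_sum_erase _ _ (Finset.mem_univ k),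
      ← Finset.add_sum_erase _ _ (Finset.mem_univ k)]
    have := Finset.sum_le_sum (s := Finset.univ.erase k)
      (fun j _ => (h.pairCount_le ω n k j).2)
    have h0 : challengerPulls ihat C I n k k ω = 0 := by
      rw [challengerPulls_eq (h.challenger_ne ω) (h.pull_challenger ω) (h.pull_leader ω),
        if_pos (h.pairCount_self ω n k)]
    rw [h0]
    omega
  rw [← Finset.mul_sum, Finset.sum_add_distrib, e1, e2] at e4
  simp only [Finset.sum_const, Finset.card_univ, Fintype.card_fin, smul_eq_mul] at e4
  omega

/-- No additive loss here, since the rounding of the tracking rule always favours the challenger. -/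
theorem IsEBTCRun.leadCount_challenger_le (h : IsEBTCRun P ν ε₀ (1 / 2) ihat C I X) (ω : Ω)
    (n : ℕ) (k : Fin K) :
    leadCount C n k ω ≤
      2 * ((Finset.Ioo K n).filter (fun t => C t ω = k ∧ I t ω = k)).card := by
  have e1 : ∑ i, pairCount ihat C n i k ω = leadCount C n k ω := by
    rw [leadCount, ← sum_card_filter_and (fun t => C t ω = k) (fun t => ihat t ω)]
    refine Finset.sum_congr rfl fun j _ => congrArg _ (Finset.filter_congr fun t _ => and_comm)
  have e2 : ∑ i, challengerPulls ihat C I n i k ω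
      = ((Finset.Ioo K n).filter (fun t => C t ω = k ∧ I t ω = k)).card := by
    rw [← sum_card_filter_and (fun t => C t ω = k ∧ I t ω = k) (fun t => ihat t ω)]
    refine Finset.sum_congr rfl fun j _ => congrArg _ (Finset.filter_congr fun t _ => ?_)
    tauto
  have := Finset.sum_le_sum (s := Finset.univ) (fun i _ => (h.pairCount_le ω n i k).1)
  rwa [← Finset.mul_sum, e1, e2] at this

/-- The two kinds of rounds are disjoint, and the arm is pulled in both; the extra 1 is its pull
during the initialization. -/
theorem IsEBTCRun.card_add_card_le_pulls (h : IsEBTCRun P ν ε₀ (1 / 2) ihat C I X) (ω : Ω)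
    {n : ℕ} (hn : K < n) (k : Fin K) :
    1 + (((Finset.Ioo K n).filter (fun t => ihat t ω = k ∧ I t ω ≠ C t ω)).card
      + ((Finset.Ioo K n).filter (fun t => C t ω = k ∧ I t ω = k)).card) ≤ pulls I n k ω := by
  refine le_trans (Nat.add_le_add_left ?_ 1) (one_add_card_filter_le_pulls (h.init ω) hn k)
  rw [← Finset.card_union_of_disjoint]
  · apply Finset.card_le_card
    intro t
    simp only [Finset.mem_union, Finset.mem_filter]
    rintro (⟨ht, rfl, h2⟩ | ⟨ht, -, h2⟩)
    · refine ⟨ht, ?_⟩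
      have hK := (Finset.mem_Ioo.1 ht).1
      exact h.pull_leader ω t hK (lt_of_not_ge fun hc => h2 (h.pull_challenger ω t hK hc))
    · exact ⟨ht, h2⟩
  · rw [Finset.disjoint_left]
    simp only [Finset.mem_filter]
    rintro t ⟨-, -, h2⟩ ⟨-, h3, h4⟩
    exact h2 (h4.trans h3.symm)

/-- Rounds in which an arm is leader or challenger, against its number of pulls. -/
theorem IsEBTCRun.leadCount_add_le (h : IsEBTCRun P ν ε₀ (1 / 2) ihat C I X) (ω : Ω)
    {n : ℕ} (hn : K < n) (k : Fin K) :
    leadCount ihat n k ω + leadCount C n k ω + 4 ≤ 2 * pulls I n k ω + 2 * K := by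
  have h1 := h.leadCount_le ω n k
  have h2 := h.leadCount_challenger_le ω n k
  have h3 := h.card_add_card_le_pulls ω hn k
  omega

theorem IsEBTCRun.leadCount_challenger_le_pulls (h : IsEBTCRun P ν ε₀ (1 / 2) ihat C I X)
    (ω : Ω) {n : ℕ} (hn : K < n) (k : Fin K) :
    leadCount C n k ω + 2 ≤ 2 * pulls I n k ω := by
  have h2 := h.leadCount_challenger_le ω n k
  have h3 := h.card_add_card_le_pulls ω hn k
  omega

/-- The rounds in `S`, all with the arm `k` as leader or challenger, in which `k` has been pulled
at most `D` times. -/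
theorem IsEBTCRun.card_le_of_pulls_le (h : IsEBTCRun P ν ε₀ (1 / 2) ihat C I X) (ω : Ω)
    (hK : 2 ≤ K) {T : ℕ} {D : ℝ} (hD : 0 ≤ D) (k : Fin K) {S : Finset ℕ}
    (hS : S ⊆ Finset.Ioo K T) (hk : ∀ t ∈ S, ihat t ω = k ∨ C t ω = k)
    (hp : ∀ t ∈ S, (pulls I t k ω : ℝ) ≤ D) :
    (S.card : ℝ) ≤ 2 * D + (2 * K - 3) := by
  have hK' : (2 : ℝ) ≤ K := by exact_mod_cast hK
  rcases S.eq_empty_or_nonempty with rfl | hne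
  · simp only [Finset.card_empty, Nat.cast_zero]; linarith
  -- The pull bound is used only in the last round of S; all other rounds of S come before it and
  -- are counted by `leadCount`.
  set m := S.max' hne
  have hm : m ∈ S := S.max'_mem hne
  have hmK : K < m := (Finset.mem_Ioo.1 (hS hm)).1
  have h1 : S.card ≤ leadCount ihat m k ω + leadCount C m k ω + 1 := by
    rw [← Finset.card_erase_add_one hm]
    refine Nat.add_le_add_right (le_trans (Finset.card_le_card ?_) (Finset.card_union_le _ _)) 1
    intro t ht
    have htS := Finset.mem_of_mem_erase ht
    have := lt_of_le_of_ne (S.le_max' t htS) (Finset.ne_of_mem_erase ht)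
    have hI : t ∈ Finset.Ioo K m := Finset.mem_Ioo.2 ⟨(Finset.mem_Ioo.1 (hS htS)).1, this⟩
    simp only [Finset.mem_union, Finset.mem_filter]
    exact (hk t htS).imp (fun e => ⟨hI, e⟩) (fun e => ⟨hI, e⟩)
  have h2 := h.leadCount_add_le ω hmK k
  have h3 := hp m hm
  have h4 : (S.card : ℝ) + 3 ≤ 2 * pulls I m k ω + 2 * K := by
    exact_mod_cast (by omega : S.card + 3 ≤ 2 * pulls I m k ω + 2 * K)
  linarith

/-- The rounds in `S`, all with the challenger `k`, in which `k` has been pulled at most `D`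
times. -/
theorem IsEBTCRun.card_le_of_challenger_of_pulls_le
    (h : IsEBTCRun P ν ε₀ (1 / 2) ihat C I X) (ω : Ω)
    {T : ℕ} {D : ℝ} (hD : 0 ≤ D) (k : Fin K) {S : Finset ℕ}
    (hS : S ⊆ Finset.Ioo K T) (hk : ∀ t ∈ S, C t ω = k)
    (hp : ∀ t ∈ S, (pulls I t k ω : ℝ) ≤ D) :
    (S.card : ℝ) ≤ 2 * D := by
  rcases S.eq_empty_or_nonempty with rfl | hne
  · simp only [Finset.card_empty, Nat.cast_zero]; linarith
  set m := S.max' hne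
  have hm : m ∈ S := S.max'_mem hne
  have hmK : K < m := (Finset.mem_Ioo.1 (hS hm)).1
  have h1 : S.card ≤ leadCount C m k ω + 1 := by
    rw [← Finset.card_erase_add_one hm]
    refine Nat.add_le_add_right (Finset.card_le_card ?_) 1
    intro t ht
    have htS := Finset.mem_of_mem_erase ht
    have := lt_of_le_of_ne (S.le_max' t htS) (Finset.ne_of_mem_erase ht)
    exact Finset.mem_filter.2 ⟨Finset.mem_Ioo.2 ⟨(Finset.mem_Ioo.1 (hS htS)).1, this⟩, hk t htS⟩
  have h2 := h.leadCount_challenger_le_pulls ω hmK k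
  have h3 := hp m hm
  have h4 : (S.card : ℝ) ≤ 2 * pulls I m k ω := by
    exact_mod_cast (by omega : S.card ≤ 2 * pulls I m k ω)
  linarith

/-- A long run has a round whose leader and challenger have both been pulled often. -/
theorem IsEBTCRun.exists_pulls_gt (h : IsEBTCRun P ν ε₀ (1 / 2) ihat C I X) (ω : Ω)
    (hK : 2 ≤ K) {T : ℕ} {D : Fin K → ℝ} (hD : ∀ k, 0 ≤ D k)
    (hT : 2 * ∑ k, D k + 5 * (K : ℝ) ^ 2 / 2 < T) :
    ∃ t, K < t ∧ t < T ∧ D (ihat t ω) < pulls I t (ihat t ω) ω ∧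
      D (C t ω) < pulls I t (C t ω) ω := by
  classical
  by_contra! hcon
  -- Each round is charged to an undersampled arm among its leader and challenger.
  let a : ℕ → Fin K := fun t =>
    if (pulls I t (ihat t ω) ω : ℝ) ≤ D (ihat t ω) then ihat t ω else C t ω
  have hcard := Finset.card_eq_sum_card_fiberwise (f := a) (s := Finset.Ioo K T)
    (t := Finset.univ) (by simp)
  have hb : ∀ k, (((Finset.Ioo K T).filter (fun t => a t = k)).card : ℝ)
      ≤ 2 * D k + (2 * K - 3) := by
    intro k
    refine h.card_le_of_pulls_le ω hK (hD k) k (Finset.filter_subset _ _) ?_ ?_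
    · intro t ht
      obtain ⟨-, rfl⟩ := Finset.mem_filter.1 ht
      by_cases hc : (pulls I t (ihat t ω) ω : ℝ) ≤ D (ihat t ω)
      · left; simp [a, hc]
      · right; simp [a, hc]
    · intro t ht
      obtain ⟨hI, rfl⟩ := Finset.mem_filter.1 ht
      by_cases hc : (pulls I t (ihat t ω) ω : ℝ) ≤ D (ihat t ω)
      · simp only [a, hc, if_true]
      · have := Finset.mem_Ioo.1 hI
        simp only [a, hc, if_false]
        exact hcon t this.1 this.2 (not_le.1 hc)
  have hsum : ((Finset.Ioo K T).card : ℝ) ≤ 2 * ∑ k, D k + K * (2 * K - 3) := by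
    rw [hcard, Nat.cast_sum]
    refine (Finset.sum_le_sum fun k _ => hb k).trans_eq ?_
    rw [Finset.sum_add_distrib, ← Finset.mul_sum]
    simp
    ring
  have hle : (T : ℝ) ≤ (Finset.Ioo K T).card + K + 1 := by
    rw [Nat.card_Ioo]; exact_mod_cast (by omega : T ≤ T - K - 1 + K + 1)
  have hK' : (2 : ℝ) ≤ K := by exact_mod_cast hK
  nlinarith

/-- If leaders outside `G` occur only in rounds where leader or challenger has been pulled seldom,
then in a long run an arm of `G` is pulled often. -/
theorem IsEBTCRun.exists_mem_pulls_ge (h : IsEBTCRun P ν ε₀ (1 / 2) ihat C I X) (ω : Ω)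
    (hK : 2 ≤ K) {T : ℕ} (hKT : K < T) {D : Fin K → ℝ} (hD : ∀ k, 0 ≤ D k) (G : Finset (Fin K))
    {q : ℝ}
    (hG : ∀ t, K < t → t < T → ihat t ω ∉ G →
      (pulls I t (ihat t ω) ω : ℝ) ≤ D (ihat t ω) ∨ (pulls I t (C t ω) ω : ℝ) ≤ D (C t ω))
    (hT : 2 * ∑ k, D k + 2 * (G.card * q) + 5 * (K : ℝ) ^ 2 / 2 < T) :
    ∃ k ∈ G, q ≤ pulls I T k ω := by
  classical
  by_contra! hcon
  -- A round is charged to its leader if that lies in G, and otherwise to an undersampled arm of the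
  -- pair.
  let a : ℕ → Fin K := fun t =>
    if ihat t ω ∈ G then ihat t ω else
    if (pulls I t (ihat t ω) ω : ℝ) ≤ D (ihat t ω) then ihat t ω else C t ω
  have hcard := Finset.card_eq_sum_card_fiberwise (f := a) (s := Finset.Ioo K T)
    (t := Finset.univ) (by simp)
  have hK' : (2 : ℝ) ≤ K := by exact_mod_cast hK
  have hb : ∀ k, (((Finset.Ioo K T).filter (fun t => a t = k)).card : ℝ)
      ≤ 2 * D k + (2 * K - 3) + if k ∈ G then 2 * q else 0 := by
    intro k
    by_cases hk : k ∈ G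
    · rw [if_pos hk]
      -- A leader outside G differs from k ∈ G, so k is charged as challenger here. The bound for
      -- challengers has no additive term, and the term 2K - 3 is paid only once for k.
      have h1 : (((Finset.Ioo K T).filter (fun t => a t = k ∧ ihat t ω ∉ G)).card : ℝ)
          ≤ 2 * D k := by
        have hkey : ∀ t ∈ (Finset.Ioo K T).filter (fun t => a t = k ∧ ihat t ω ∉ G),
            ¬ (pulls I t (ihat t ω) ω : ℝ) ≤ D (ihat t ω) ∧ C t ω = k := by
          intro t ht
          obtain ⟨-, rfl, h2⟩ := Finset.mem_filter.1 ht
          by_cases hc : (pulls I t (ihat t ω) ω : ℝ) ≤ D (ihat t ω)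
          · simp only [a, h2, hc, if_true, if_false] at hk
          · exact ⟨hc, by simp only [a, h2, hc, if_false]⟩
        refine h.card_le_of_challenger_of_pulls_le ω (hD k) k (Finset.filter_subset _ _)
          (fun t ht => (hkey t ht).2) fun t ht => ?_
        obtain ⟨h3, h4⟩ := hkey t ht
        obtain ⟨h5, -, h7⟩ := Finset.mem_filter.1 ht
        have h6 := Finset.mem_Ioo.1 h5
        rw [← h4]
        exact (hG t h6.1 h6.2 h7).resolve_left h3
      have h2 : ((Finset.Ioo K T).filter (fun t => a t = k)).card
          ≤ leadCount ihat T k ω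
            + ((Finset.Ioo K T).filter (fun t => a t = k ∧ ihat t ω ∉ G)).card := by
        refine le_trans (Finset.card_le_card ?_) (Finset.card_union_le _ _)
        intro t ht
        obtain ⟨h5, h6⟩ := Finset.mem_filter.1 ht
        simp only [Finset.mem_union, Finset.mem_filter]
        by_cases hg : ihat t ω ∈ G
        · left; exact ⟨h5, by simpa [a, hg] using h6⟩
        · right; exact ⟨h5, h6, hg⟩
      have h3 := h.leadCount_add_le ω hKT k
      have h4 := hcon k hk
      have h5 : (leadCount ihat T k ω : ℝ) + 4 ≤ 2 * pulls I T k ω + 2 * K := by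
        exact_mod_cast (by omega : leadCount ihat T k ω + 4 ≤ 2 * pulls I T k ω + 2 * K)
      have h6 : (((Finset.Ioo K T).filter (fun t => a t = k)).card : ℝ)
          ≤ leadCount ihat T k ω
            + ((Finset.Ioo K T).filter (fun t => a t = k ∧ ihat t ω ∉ G)).card := by
        exact_mod_cast h2
      linarith
    · rw [if_neg hk, add_zero]
      refine h.card_le_of_pulls_le ω hK (hD k) k (Finset.filter_subset _ _) ?_ ?_
      · intro t ht
        obtain ⟨-, rfl⟩ := Finset.mem_filter.1 ht
        by_cases hg : ihat t ω ∈ G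
        · left; simp [a, hg]
        by_cases hc : (pulls I t (ihat t ω) ω : ℝ) ≤ D (ihat t ω)
        · left; simp [a, hc]
        · right; simp [a, hc, hg]
      · intro t ht
        obtain ⟨hI, rfl⟩ := Finset.mem_filter.1 ht
        have hg : ihat t ω ∉ G := fun hg => hk (by simp [a, hg])
        by_cases hc : (pulls I t (ihat t ω) ω : ℝ) ≤ D (ihat t ω)
        · simp only [a, hg, hc, if_true, if_false]
        · have := Finset.mem_Ioo.1 hI
          simp only [a, hg, hc, if_false]
          exact (hG t this.1 this.2 hg).resolve_left hc
  have hsum : ((Finset.Ioo K T).card : ℝ)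
      ≤ 2 * ∑ k, D k + K * (2 * K - 3) + 2 * (G.card * q) := by
    rw [hcard, Nat.cast_sum]
    refine (Finset.sum_le_sum fun k _ => hb k).trans_eq ?_
    rw [Finset.sum_add_distrib, Finset.sum_add_distrib, ← Finset.mul_sum]
    simp
    ring
  have hle : (T : ℝ) ≤ (Finset.Ioo K T).card + K + 1 := by
    rw [Nat.card_Ioo]; exact_mod_cast (by omega : T ≤ T - K - 1 + K + 1)
  nlinarith

end Counting

/-! ### Concentration -/

section Concentration

variable {Ω : Type*} {K : ℕ}

/-- Concentration: until time `T` for the differences of two empirical means, at level `f`, and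
at all times, once the arm `k` has been pulled `2 f / y_k ^ 2` times, for the empirical mean of `k`
in the direction `σ_k`. -/
def IsConcentrated (μ : Fin K → ℝ) (I : ℕ → Ω → Fin K) (X : ℕ → Ω → ℝ) (T : ℕ) (f : ℝ)
    (σ y : Fin K → ℝ) (ω : Ω) : Prop :=
  (∀ i j, i ≠ j → ∀ t, K < t → t ≤ T →
    (empMean I X t i ω - μ i) - (empMean I X t j ω - μ j) <
      Real.sqrt (2 * f) * Real.sqrt (1 / (pulls I t i ω : ℝ) + 1 / (pulls I t j ω : ℝ))) ∧
  ∀ k t, f ≤ pulls I t k ω * (y k ^ 2 / 2) → σ k * (empMean I X t k ω - μ k) < y k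

theorem pulls_add_pulls_lt (I : ℕ → Ω → Fin K) {i j : Fin K} (hij : i ≠ j) {t : ℕ} (ht : 1 ≤ t)
    (ω : Ω) : pulls I t i ω + pulls I t j ω < t := by
  have h : pulls I t i ω + pulls I t j ω ≤ (Finset.Ico 1 t).card := by
    rw [pulls, pulls, ← Finset.card_union_of_disjoint]
    · exact Finset.card_le_card (Finset.union_subset (Finset.filter_subset _ _)
        (Finset.filter_subset _ _))
    · rw [Finset.disjoint_filter]
      intro s _ h1 h2
      exact hij (h1.symm.trans h2)
  rw [Nat.card_Ico] at h
  omega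

variable [mΩ : MeasurableSpace Ω] {P : Measure Ω} [IsProbabilityMeasure P]
  {ν : Fin K → Measure ℝ} {ε₀ β : ℝ} {ihat C I : ℕ → Ω → Fin K} {X : ℕ → Ω → ℝ}

/-- A union bound over pairs of pull counts. Both counts are at least 1 and their sum m is below T,
so there are at most T²/2 pairs. -/
theorem IsEBTCRun.measure_pair_forall_le (h : IsEBTCRun P ν ε₀ β ihat C I X)
    (hprob : ∀ k, IsProbabilityMeasure (ν k)) (hsub : ∀ k, IsOneSubGaussian (ν k))
    {i j : Fin K} (hij : i ≠ j) (T : ℕ) {f : ℝ} (hf : 0 ≤ f) :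
    P {ω | ∃ t, K < t ∧ t ≤ T ∧
        Real.sqrt (2 * f) * Real.sqrt (1 / (pulls I t i ω : ℝ) + 1 / (pulls I t j ω : ℝ)) ≤
          (empMean I X t i ω - armMean ν i) - (empMean I X t j ω - armMean ν j)}
      ≤ ENNReal.ofReal ((T : ℝ) ^ 2 / 2 * Real.exp (-f)) := by
  let S : ℕ → ℕ → Set Ω := fun a b =>
    {ω | ∃ t ≤ T, pulls I t i ω = a ∧ pulls I t j ω = b ∧
        Real.sqrt (2 * f) * Real.sqrt (1 / (a : ℝ) + 1 / (b : ℝ)) ≤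
          (empMean I X t i ω - armMean ν i) - (empMean I X t j ω - armMean ν j)}
  refine le_trans (measure_mono
    (t := ⋃ m ∈ Finset.range T, ⋃ a ∈ Finset.Ico 1 m, S a (m - a)) ?_) ?_
  · rintro ω ⟨t, hKt, htT, hdev⟩
    have h1 := pulls_add_pulls_lt I hij (by omega : 1 ≤ t) ω
    have h2 := one_le_pulls (h.init ω) hKt i
    have h3 := one_le_pulls (h.init ω) hKt j
    simp only [Set.mem_iUnion]
    refine ⟨pulls I t i ω + pulls I t j ω, Finset.mem_range.2 (by omega), pulls I t i ω,
      Finset.mem_Ico.2 (by omega), ?_⟩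
    rw [Nat.add_sub_cancel_left]
    exact ⟨t, htT, rfl, rfl, hdev⟩
  · calc P (⋃ m ∈ Finset.range T, ⋃ a ∈ Finset.Ico 1 m, S a (m - a))
        ≤ ∑ m ∈ Finset.range T, P (⋃ a ∈ Finset.Ico 1 m, S a (m - a)) :=
          measure_biUnion_finset_le _ _
      _ ≤ ∑ m ∈ Finset.range T, ∑ a ∈ Finset.Ico 1 m, P (S a (m - a)) :=
          Finset.sum_le_sum fun m _ => measure_biUnion_finset_le _ _
      _ ≤ ∑ m ∈ Finset.range T, ∑ a ∈ Finset.Ico 1 m, ENNReal.ofReal (Real.exp (-f)) := by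
          refine Finset.sum_le_sum fun m _ => Finset.sum_le_sum fun a ha => ?_
          have := Finset.mem_Ico.1 ha
          exact h.measure_pair_le hprob hsub hij this.1 (by omega) T hf
      _ ≤ ∑ m ∈ Finset.range T, ENNReal.ofReal (m * Real.exp (-f)) := by
          refine Finset.sum_le_sum fun m _ => ?_
          rw [Finset.sum_const, Nat.card_Ico, nsmul_eq_mul, ENNReal.ofReal_mul (by positivity),
            ENNReal.ofReal_natCast]
          gcongr
          omega
      _ = ENNReal.ofReal ((∑ m ∈ Finset.range T, (m : ℝ)) * Real.exp (-f)) := by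
          rw [← ENNReal.ofReal_sum_of_nonneg (fun _ _ => by positivity), Finset.sum_mul]
      _ ≤ _ := by
          apply ENNReal.ofReal_le_ofReal
          refine mul_le_mul_of_nonneg_right ?_ (Real.exp_pos _).le
          have h1 := Finset.sum_range_id_mul_two T
          have h2 : (∑ m ∈ Finset.range T, m) * 2 ≤ T ^ 2 := by
            rw [h1, sq]; exact Nat.mul_le_mul_left _ (Nat.sub_le _ _)
          have h3 : (∑ m ∈ Finset.range T, (m : ℝ)) * 2 ≤ (T : ℝ) ^ 2 := by
            have := (Nat.cast_le (α := ℝ)).2 h2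
            push_cast at this
            exact this
          linarith

/-- The K(K-1) ordered pairs cost T²/2 each and the K single arms T² each, by `hyT`; together
K(K+1)/2 · T², in units of e^{-f}. -/
theorem IsEBTCRun.one_le_measure_isConcentrated_add (h : IsEBTCRun P ν ε₀ β ihat C I X)
    (hprob : ∀ k, IsProbabilityMeasure (ν k)) (hsub : ∀ k, IsOneSubGaussian (ν k))
    (T : ℕ) {f : ℝ} (hf : 0 < f) {σ y : Fin K → ℝ} (hσ : ∀ k, σ k ^ 2 = 1) (hy : ∀ k, 0 < y k)
    (hyT : ∀ k, 1 + 1 / (y k ^ 2 / 2) ≤ (T : ℝ) ^ 2) :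
    1 ≤ P {ω | IsConcentrated (armMean ν) I X T f σ y ω}
      + ENNReal.ofReal ((K : ℝ) * (K + 1) / 2 * (T : ℝ) ^ 2 * Real.exp (-f)) := by
  let S1 : Fin K → Fin K → Set Ω := fun i j => {ω | ∃ t, K < t ∧ t ≤ T ∧
        Real.sqrt (2 * f) * Real.sqrt (1 / (pulls I t i ω : ℝ) + 1 / (pulls I t j ω : ℝ)) ≤
          (empMean I X t i ω - armMean ν i) - (empMean I X t j ω - armMean ν j)}
  let S2 : Fin K → Set Ω := fun k =>
    {ω | ∃ t, f ≤ pulls I t k ω * (y k ^ 2 / 2) ∧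
      y k ≤ σ k * (empMean I X t k ω - armMean ν k)}
  have hcover : (Set.univ : Set Ω) ⊆ {ω | IsConcentrated (armMean ν) I X T f σ y ω}
      ∪ ((⋃ i ∈ Finset.univ, ⋃ j ∈ Finset.univ.erase i, S1 i j) ∪ ⋃ k ∈ Finset.univ, S2 k) := by
    intro ω _
    by_contra hcon
    simp only [Set.mem_union, not_or, Set.mem_iUnion, not_exists] at hcon
    obtain ⟨h0, h1, h2⟩ := hcon
    apply h0
    refine ⟨fun i j hij t ht1 ht2 => lt_of_not_ge fun hc => ?_,
      fun k t hk => lt_of_not_ge fun hc => ?_⟩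
    · exact h1 i (Finset.mem_univ i) j (Finset.mem_erase.2 ⟨hij.symm, Finset.mem_univ j⟩)
        ⟨t, ht1, ht2, hc⟩
    · exact h2 k (Finset.mem_univ k) ⟨t, hk, hc⟩
  have b1 : P (⋃ i ∈ Finset.univ, ⋃ j ∈ Finset.univ.erase i, S1 i j)
      ≤ ENNReal.ofReal ((K : ℝ) * (K - 1) * ((T : ℝ) ^ 2 / 2 * Real.exp (-f))) := by
    refine (measure_biUnion_finset_le _ _).trans ((Finset.sum_le_sum fun i _ =>
      (measure_biUnion_finset_le _ _).trans (Finset.sum_le_sum fun j hj =>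
        h.measure_pair_forall_le hprob hsub (Finset.ne_of_mem_erase hj).symm T hf.le)).trans
      (le_of_eq ?_))
    simp only [Finset.sum_const, Finset.card_erase_of_mem (Finset.mem_univ _), Finset.card_univ,
      Fintype.card_fin, ← mul_nsmul']
    rw [← ENNReal.ofReal_nsmul, nsmul_eq_mul]
    congr 2
    rcases Nat.eq_zero_or_pos K with rfl | hK
    · simp
    · push_cast [Nat.cast_sub hK]
      ring
  have b2 : P (⋃ k ∈ Finset.univ, S2 k)
      ≤ ENNReal.ofReal (K * ((T : ℝ) ^ 2 * Real.exp (-f))) := by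
    refine (measure_biUnion_finset_le _ _).trans ((Finset.sum_le_sum fun k _ =>
      (h.measure_single_forall_le hprob hsub k (hσ k) (hy k) hf).trans
      (ENNReal.ofReal_le_ofReal (mul_le_mul_of_nonneg_right (hyT k)
        (Real.exp_pos _).le))).trans (le_of_eq ?_))
    simp only [Finset.sum_const, Finset.card_univ, Fintype.card_fin]
    rw [← ENNReal.ofReal_nsmul, nsmul_eq_mul]
  -- Adding the two bounds needs K - 1 ≥ 0; without arms there is no process I.
  rcases Nat.eq_zero_or_pos K with hK | hK
  · subst hK
    have : Nonempty Ω := nonempty_of_isProbabilityMeasure P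
    exact (I 0 (Classical.arbitrary Ω)).elim0
  have hK1 : (1 : ℝ) ≤ K := by exact_mod_cast hK
  calc (1 : ℝ≥0∞) = P Set.univ := measure_univ.symm
    _ ≤ P {ω | IsConcentrated (armMean ν) I X T f σ y ω}
        + (P (⋃ i ∈ Finset.univ, ⋃ j ∈ Finset.univ.erase i, S1 i j)
          + P (⋃ k ∈ Finset.univ, S2 k)) :=
        (measure_mono hcover).trans ((measure_union_le _ _).trans
          (add_le_add_right (measure_union_le _ _) _))
    _ ≤ _ := by
        refine add_le_add_right ((add_le_add b1 b2).trans (le_of_eq ?_)) _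
        rw [← ENNReal.ofReal_add]
        · congr 1
          ring
        · have : (0 : ℝ) ≤ K - 1 := by linarith
          positivity
        · positivity

end Concentration

/-! ### Sorted gaps -/

section Gaps

variable {K : ℕ} {μ : Fin K → ℝ}

theorem le_maxMean (μ : Fin K → ℝ) (k : Fin K) : μ k ≤ maxMean μ :=
  le_ciSup (Set.finite_range μ).bddAbove k

theorem exists_eq_maxMean (hK : 0 < K) (μ : Fin K → ℝ) : ∃ k, μ k = maxMean μ := by
  have : Nonempty (Fin K) := ⟨⟨0, hK⟩⟩
  exact exists_eq_ciSup_of_finite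

theorem numClasses_pos (hK : 0 < K) (μ : Fin K → ℝ) : 0 < numClasses μ := by
  have : Nonempty (Fin K) := ⟨⟨0, hK⟩⟩
  exact Finset.card_pos.2 (Finset.univ_nonempty.image _)

theorem exists_gap_eq_sortedGap (μ : Fin K → ℝ) (k : Fin K) :
    ∃ m, 1 ≤ m ∧ m ≤ numClasses μ ∧ maxMean μ - μ k = sortedGap μ m := by
  have h : maxMean μ - μ k ∈ Set.range ((gapSet μ).orderEmbOfFin (card_gapSet μ)) := by
    rw [Finset.range_orderEmbOfFin]
    simp [gapSet]
  obtain ⟨⟨m, hm⟩, e⟩ := h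
  refine ⟨m + 1, by omega, hm, ?_⟩
  rw [sortedGap, dif_pos (by simpa using hm)]
  exact e.symm

theorem exists_sortedGap_eq_gap {m : ℕ} (h1 : 1 ≤ m) (hm : m ≤ numClasses μ) :
    ∃ k, sortedGap μ m = maxMean μ - μ k := by
  rw [sortedGap, dif_pos (by omega)]
  have := (gapSet μ).orderEmbOfFin_mem (card_gapSet μ) ⟨m - 1, by omega⟩
  obtain ⟨k, -, hk⟩ := Finset.mem_image.1 this
  exact ⟨k, hk.symm⟩

theorem sortedGap_lt_sortedGap {i j : ℕ} (h1 : 1 ≤ i) (hij : i < j) (hj : j ≤ numClasses μ) :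
    sortedGap μ i < sortedGap μ j := by
  rw [sortedGap, sortedGap, dif_pos (by omega), dif_pos (by omega)]
  apply (OrderEmbedding.lt_iff_lt _).2
  rw [Fin.mk_lt_mk]
  omega

theorem sortedGap_le_sortedGap {i j : ℕ} (h1 : 1 ≤ i) (hij : i ≤ j) (hj : j ≤ numClasses μ) :
    sortedGap μ i ≤ sortedGap μ j := by
  rcases hij.eq_or_lt with rfl | h
  · exact le_rfl
  · exact (sortedGap_lt_sortedGap h1 h hj).le

theorem sortedGap_nonneg {i : ℕ} (h1 : 1 ≤ i) (hi : i ≤ numClasses μ) : 0 ≤ sortedGap μ i := by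
  obtain ⟨k, hk⟩ := exists_sortedGap_eq_gap h1 hi
  rw [hk]
  linarith [le_maxMean μ k]

theorem sortedGap_one (hK : 0 < K) (μ : Fin K → ℝ) : sortedGap μ 1 = 0 := by
  obtain ⟨k, hk⟩ := exists_eq_maxMean hK μ
  obtain ⟨m, h1, hm, e⟩ := exists_gap_eq_sortedGap μ k
  have := sortedGap_le_sortedGap le_rfl h1 hm
  have := sortedGap_nonneg (μ := μ) le_rfl (numClasses_pos hK μ)
  linarith

theorem sortedGap_pos (hK : 0 < K) {i : ℕ} (h1 : 1 < i) (hi : i ≤ numClasses μ) :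
    0 < sortedGap μ i :=
  (sortedGap_one hK μ).symm.trans_lt (sortedGap_lt_sortedGap le_rfl h1 hi)

/-- The index of the class of an arm. -/
noncomputable def gapIndex (μ : Fin K → ℝ) (k : Fin K) : ℕ :=
  (exists_gap_eq_sortedGap μ k).choose

theorem one_le_gapIndex (μ : Fin K → ℝ) (k : Fin K) : 1 ≤ gapIndex μ k :=
  (exists_gap_eq_sortedGap μ k).choose_spec.1

theorem gapIndex_le (μ : Fin K → ℝ) (k : Fin K) : gapIndex μ k ≤ numClasses μ :=
  (exists_gap_eq_sortedGap μ k).choose_spec.2.1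

theorem gap_eq (μ : Fin K → ℝ) (k : Fin K) :
    maxMean μ - μ k = sortedGap μ (gapIndex μ k) :=
  (exists_gap_eq_sortedGap μ k).choose_spec.2.2

theorem gapIndex_eq_iff {k : Fin K} {m : ℕ} (h1 : 1 ≤ m) (hm : m ≤ numClasses μ) :
    gapIndex μ k = m ↔ maxMean μ - μ k = sortedGap μ m := by
  constructor
  · rintro rfl
    exact gap_eq μ k
  · intro h
    rw [gap_eq] at h
    rcases lt_trichotomy (gapIndex μ k) m with h' | h' | h'
    · exact absurd h (sortedGap_lt_sortedGap (one_le_gapIndex μ k) h' hm).ne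
    · exact h'
    · exact absurd h (sortedGap_lt_sortedGap h1 h' (gapIndex_le μ k)).ne'

theorem card_filter_gapIndex {m : ℕ} (h1 : 1 ≤ m) (hm : m ≤ numClasses μ) :
    (Finset.univ.filter (fun k => gapIndex μ k = m)).card = classSize μ m := by
  rw [classSize]
  congr 1
  exact Finset.filter_congr fun k _ => gapIndex_eq_iff h1 hm

/-- Converts sums over arms, as produced by the counting of rounds, into the sums over classes in
the complexities. -/
theorem sum_comp_gapIndex (μ : Fin K → ℝ) (F : ℕ → ℝ) :
    ∑ k, F (gapIndex μ k) = ∑ m ∈ Finset.Icc 1 (numClasses μ), (classSize μ m : ℝ) * F m := by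
  rw [← Finset.sum_fiberwise_of_maps_to (g := gapIndex μ) (t := Finset.Icc 1 (numClasses μ))
    (fun k _ => Finset.mem_Icc.2 ⟨one_le_gapIndex μ k, gapIndex_le μ k⟩)]
  refine Finset.sum_congr rfl fun m hm => ?_
  rw [Finset.mem_Icc] at hm
  rw [← card_filter_gapIndex hm.1 hm.2, ← nsmul_eq_mul, ← Finset.sum_const]
  exact Finset.sum_congr rfl fun k hk => by rw [(Finset.mem_filter.1 hk).2]

theorem card_filter_gapIndex_le {j : ℕ} (hj : j ≤ numClasses μ) :
    ((Finset.univ.filter (fun k => gapIndex μ k ≤ j)).card : ℝ)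
      = ∑ m ∈ Finset.Icc 1 j, (classSize μ m : ℝ) := by
  have h := sum_comp_gapIndex μ (fun m => if m ≤ j then 1 else 0)
  simp only [mul_ite, mul_one, mul_zero, Finset.sum_ite, Finset.sum_const_zero, add_zero,
    Finset.sum_const, nsmul_eq_mul] at h
  rw [h]
  congr 1
  ext m
  simp only [Finset.mem_filter, Finset.mem_Icc]
  omega

theorem card_bestArms (hK : 0 < K) (μ : Fin K → ℝ) : (bestArms μ).card = classSize μ 1 := by
  rw [bestArms, classSize, sortedGap_one hK]
  congr 1
  exact Finset.filter_congr fun k _ => ⟨fun h => by linarith, fun h => by linarith⟩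

theorem one_le_classSize_one (hK : 0 < K) (μ : Fin K → ℝ) : 1 ≤ classSize μ 1 := by
  rw [← card_bestArms hK]
  obtain ⟨k, hk⟩ := exists_eq_maxMean hK μ
  exact Finset.card_pos.2 ⟨k, by simp [bestArms, hk]⟩

theorem sum_Icc_split (F : ℕ → ℝ) {i j n : ℕ} (hj : 1 ≤ j) (hji : j ≤ i) (hin : i ≤ n) :
    ∑ m ∈ Finset.Icc 1 n, F m = F 1 + ∑ m ∈ Finset.Icc 2 j, F m
      + ∑ m ∈ Finset.Icc (j + 1) i, F m + ∑ m ∈ Finset.Icc (i + 1) n, F m := by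
  have e : ∀ a b : ℕ, Finset.Icc (a + 1) b = Finset.Ioc a b := fun a b => by
    ext x; simp only [Finset.mem_Icc, Finset.mem_Ioc]; omega
  rw [show (1 : ℕ) = 0 + 1 from rfl, show (2 : ℕ) = 1 + 1 from rfl, e, e, e, e,
    ← Finset.sum_Ioc_consecutive F (Nat.zero_le i) hin,
    ← Finset.sum_Ioc_consecutive F (Nat.zero_le j) hji,
    ← Finset.sum_Ioc_consecutive F (Nat.zero_le 1) hj]
  simp

/-! ### Complexities as sums over the arms -/

/-- The term of `hBar` for an arm of class `m`, before squaring. -/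
noncomputable def barTerm (μ : Fin K → ℝ) (ε₀ : ℝ) (i j m : ℕ) : ℝ :=
  if m = 1 then max (Real.sqrt 2 * (sortedGap μ (j + 1))⁻¹) (cTwo μ ε₀ (i + 1) j)
  else if m ≤ j ∨ i < m then max (cOne μ ε₀ (j + 1)) (cTwo μ ε₀ (i + 1) j)
  else max (max (cOne μ ε₀ (j + 1)) (cTwo μ ε₀ (i + 1) j)) (Real.sqrt 2 * (sortedGap μ m)⁻¹)

/-- The term of `hTilde` for an arm of class `m`, before squaring, without the term common to the
classes up to `j`. -/
noncomputable def tildeTerm (μ : Fin K → ℝ) (ε₀ : ℝ) (j m : ℕ) : ℝ :=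
  if m = 1 then Real.sqrt 2 * (sortedGap μ (j + 1))⁻¹
  else if m ≤ j then max (cOne μ ε₀ (j + 1)) ε₀⁻¹
  else max (max (cOne μ ε₀ (j + 1)) ε₀⁻¹) (Real.sqrt 2 * (sortedGap μ m)⁻¹)

theorem sum_barTerm (hK : 0 < K) (μ : Fin K → ℝ) (ε₀ : ℝ) {i j : ℕ} (hj : 1 ≤ j) (hji : j ≤ i)
    (hi : i ≤ numClasses μ) :
    ∑ k, barTerm μ ε₀ i j (gapIndex μ k) ^ 2 = hBar μ ε₀ i j := by
  rw [sum_comp_gapIndex μ (fun m => barTerm μ ε₀ i j m ^ 2), sum_Icc_split _ hj hji hi, hBar,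
    card_bestArms hK]
  have e1 : ∑ m ∈ Finset.Icc 2 j, (classSize μ m : ℝ) * barTerm μ ε₀ i j m ^ 2
      = (max (cOne μ ε₀ (j + 1)) (cTwo μ ε₀ (i + 1) j)) ^ 2 *
        ∑ m ∈ Finset.Icc 2 j, (classSize μ m : ℝ) := by
    rw [Finset.mul_sum]
    refine Finset.sum_congr rfl fun m hm => ?_
    rw [Finset.mem_Icc] at hm
    rw [barTerm, if_neg (by omega), if_pos (by omega), mul_comm]
  have e2 : ∑ m ∈ Finset.Icc (i + 1) (numClasses μ), (classSize μ m : ℝ) * barTerm μ ε₀ i j m ^ 2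
      = (max (cOne μ ε₀ (j + 1)) (cTwo μ ε₀ (i + 1) j)) ^ 2 *
        ∑ m ∈ Finset.Icc (i + 1) (numClasses μ), (classSize μ m : ℝ) := by
    rw [Finset.mul_sum]
    refine Finset.sum_congr rfl fun m hm => ?_
    rw [Finset.mem_Icc] at hm
    rw [barTerm, if_neg (by omega), if_pos (by omega), mul_comm]
  have e3 : ∑ m ∈ Finset.Icc (j + 1) i, (classSize μ m : ℝ) * barTerm μ ε₀ i j m ^ 2
      = ∑ m ∈ Finset.Icc (j + 1) i, (classSize μ m : ℝ) *
        (max (max (cOne μ ε₀ (j + 1)) (cTwo μ ε₀ (i + 1) j))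
          (Real.sqrt 2 * (sortedGap μ m)⁻¹)) ^ 2 := by
    refine Finset.sum_congr rfl fun m hm => ?_
    rw [Finset.mem_Icc] at hm
    rw [barTerm, if_neg (by omega), if_neg (by omega)]
  rw [e1, e2, e3, barTerm, if_pos rfl]
  ring

/-- The term common to the classes up to j stays apart: it is the share of the required pulls of k₀,
while the sum comes from undersampled rounds. -/
theorem sum_tildeTerm (hK : 0 < K) (μ : Fin K → ℝ) (ε₀ : ℝ) {i j : ℕ} (hj : 1 ≤ j)
    (hjn : j ≤ numClasses μ) :
    ∑ k, tildeTerm μ ε₀ j (gapIndex μ k) ^ 2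
      + (Finset.univ.filter (fun k => gapIndex μ k ≤ j)).card *
        (2 / (sortedGap μ (i + 1) - sortedGap μ j) ^ 2) = hTilde μ ε₀ i j := by
  rw [sum_comp_gapIndex μ (fun m => tildeTerm μ ε₀ j m ^ 2),
    sum_Icc_split _ hj le_rfl hjn, hTilde, card_bestArms hK, card_filter_gapIndex_le hjn]
  have e1 : ∑ m ∈ Finset.Icc 2 j, (classSize μ m : ℝ) * tildeTerm μ ε₀ j m ^ 2
      = (max (cOne μ ε₀ (j + 1)) ε₀⁻¹) ^ 2 * ∑ m ∈ Finset.Icc 2 j, (classSize μ m : ℝ) := by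
    rw [Finset.mul_sum]
    refine Finset.sum_congr rfl fun m hm => ?_
    rw [Finset.mem_Icc] at hm
    rw [tildeTerm, if_neg (by omega), if_pos (by omega), mul_comm]
  have e3 : ∑ m ∈ Finset.Icc (j + 1) (numClasses μ), (classSize μ m : ℝ) * tildeTerm μ ε₀ j m ^ 2
      = ∑ m ∈ Finset.Icc (j + 1) (numClasses μ), (classSize μ m : ℝ) *
        (max (max (cOne μ ε₀ (j + 1)) ε₀⁻¹) (Real.sqrt 2 * (sortedGap μ m)⁻¹)) ^ 2 := by
    refine Finset.sum_congr rfl fun m hm => ?_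
    rw [Finset.mem_Icc] at hm
    rw [tildeTerm, if_neg (by omega), if_neg (by omega)]
  rw [e1, e3, tildeTerm, if_pos rfl, mul_pow, Real.sq_sqrt (by norm_num),
    Finset.Icc_eq_empty (by omega : ¬ j + 1 ≤ j), Finset.sum_empty, inv_pow]
  ring

/-- If 1/Δ ≥ 1/ε₀ then 2/Δ - 1/ε₀ ≥ 1/Δ; otherwise c suffices. The sampling argument needs only the
smaller left-hand side. -/
theorem inv_le_max_cOne {μ : Fin K → ℝ} {ε₀ c : ℝ} {i : ℕ} (hc : ε₀⁻¹ ≤ c) :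
    max (sortedGap μ i)⁻¹ ε₀⁻¹ ≤ max (cOne μ ε₀ i) c := by
  apply max_le
  · rcases le_total (sortedGap μ i)⁻¹ ε₀⁻¹ with h | h
    · exact (h.trans hc).trans (le_max_right _ _)
    · exact le_trans (by rw [cOne]; linarith) (le_max_left _ _)
  · exact hc.trans (le_max_right _ _)

theorem le_sqrt_two_mul {x : ℝ} (hx : 0 ≤ x) : x ≤ Real.sqrt 2 * x :=
  le_mul_of_one_le_left hx (Real.one_le_sqrt.2 (by norm_num))

theorem inv_le_cTwo {ε₀ : ℝ} (hε₀ : 0 < ε₀) {i j : ℕ} (hj : 1 ≤ j) (hji : j ≤ i)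
    (hi : i < numClasses μ) : ε₀⁻¹ ≤ cTwo μ ε₀ (i + 1) j := by
  have h1 := sortedGap_nonneg (μ := μ) hj (by omega)
  have h2 := sortedGap_lt_sortedGap (μ := μ) hj (by omega : j < i + 1) hi
  have h3 : 0 < sortedGap μ (i + 1) - sortedGap μ j := by linarith
  have h4 : 0 < ε₀⁻¹ := by positivity
  have h5 : 0 ≤ 2 * ((sortedGap μ j / ε₀ + 1) / (sortedGap μ (i + 1) - sortedGap μ j)) := by
    positivity
  rw [cTwo]
  linarith

theorem cTwo_le_barTerm (μ : Fin K → ℝ) (ε₀ : ℝ) (i j m : ℕ) :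
    cTwo μ ε₀ (i + 1) j ≤ barTerm μ ε₀ i j m := by
  rw [barTerm]
  split_ifs
  · exact le_max_right _ _
  · exact le_max_right _ _
  · exact (le_max_right _ _).trans (le_max_left _ _)

theorem inv_le_barTerm_one (hK : 0 < K) (ε₀ : ℝ) (i : ℕ) {j : ℕ} (hj : 1 ≤ j)
    (hjn : j < numClasses μ) : (sortedGap μ (j + 1))⁻¹ ≤ barTerm μ ε₀ i j 1 := by
  rw [barTerm, if_pos rfl]
  exact (le_sqrt_two_mul (inv_nonneg.2 (sortedGap_pos hK (by omega) hjn).le)).trans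
    (le_max_left _ _)

theorem max_inv_le_barTerm {ε₀ : ℝ} (hε₀ : 0 < ε₀) {i j m : ℕ} (hj : 1 ≤ j)
    (hji : j ≤ i) (hi : i < numClasses μ) (hm : m ≠ 1) :
    max (sortedGap μ (j + 1))⁻¹ ε₀⁻¹ ≤ barTerm μ ε₀ i j m := by
  have h := inv_le_max_cOne (μ := μ) (i := j + 1) (inv_le_cTwo (μ := μ) hε₀ hj hji hi)
  rw [barTerm, if_neg hm]
  split_ifs
  · exact h
  · exact h.trans (le_max_left _ _)

theorem inv_le_tildeTerm_one (hK : 0 < K) (ε₀ : ℝ) {j : ℕ} (hj : 1 ≤ j)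
    (hjn : j < numClasses μ) : (sortedGap μ (j + 1))⁻¹ ≤ tildeTerm μ ε₀ j 1 := by
  rw [tildeTerm, if_pos rfl]
  exact le_sqrt_two_mul (inv_nonneg.2 (sortedGap_pos hK (by omega) hjn).le)

theorem max_inv_le_tildeTerm (μ : Fin K → ℝ) (ε₀ : ℝ) (j : ℕ) {m : ℕ} (hm : m ≠ 1) :
    max (sortedGap μ (j + 1))⁻¹ ε₀⁻¹ ≤ tildeTerm μ ε₀ j m := by
  have h := inv_le_max_cOne (μ := μ) (i := j + 1) (le_refl ε₀⁻¹)
  rw [tildeTerm, if_neg hm]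
  split_ifs
  · exact h
  · exact h.trans (le_max_left _ _)

theorem hBar_pos (hK : 0 < K) {ε₀ : ℝ} (hε₀ : 0 < ε₀) {i j : ℕ} (hj : 1 ≤ j)
    (hji : j ≤ i) (hi : i < numClasses μ) : 0 < hBar μ ε₀ i j := by
  rw [← sum_barTerm hK μ ε₀ hj hji hi.le]
  have h : 0 < ε₀⁻¹ := by positivity
  exact Finset.sum_pos (fun k _ => pow_pos (h.trans_le ((inv_le_cTwo hε₀ hj hji hi).trans
    (cTwo_le_barTerm μ ε₀ i j _))) 2) ⟨⟨0, hK⟩, Finset.mem_univ _⟩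

theorem exists_complexityH_eq (μ : Fin K → ℝ) (ε₀ : ℝ) {i : ℕ} (h1 : 1 ≤ i) :
    ∃ j, 1 ≤ j ∧ j ≤ i ∧ complexityH μ ε₀ i = max (hBar μ ε₀ i j) (hTilde μ ε₀ i j) := by
  have : Nonempty (Finset.Icc 1 i) := ⟨⟨1, Finset.mem_Icc.2 ⟨le_rfl, h1⟩⟩⟩
  obtain ⟨⟨j, hj⟩, e⟩ := exists_eq_ciInf_of_finite
    (f := fun j : Finset.Icc 1 i => max (hBar μ ε₀ i j) (hTilde μ ε₀ i j))
  rw [Finset.mem_Icc] at hj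
  exact ⟨j, hj.1, hj.2, e.symm⟩

theorem complexityH_pos (hK : 0 < K) {ε₀ : ℝ} (hε₀ : 0 < ε₀) {i : ℕ} (h1 : 1 ≤ i)
    (hi : i < numClasses μ) : 0 < complexityH μ ε₀ i := by
  obtain ⟨j, hj, hji, e⟩ := exists_complexityH_eq μ ε₀ h1
  rw [e]
  exact lt_max_of_lt_left (hBar_pos hK hε₀ hj hji hi)

/-! ### Good arms in terms of classes -/

theorem goodArms_classIndex_of_lt {ε : ℝ} (hi : classIndex μ ε < numClasses μ) :
    1 ≤ classIndex μ ε ∧ ∀ k, k ∉ goodArms μ ε → classIndex μ ε < gapIndex μ k := by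
  have hne : (classIndexSet μ ε).Nonempty := by
    by_contra hc
    rw [classIndex, if_neg hc] at hi
    exact lt_irrefl _ hi
  have hmem : classIndex μ ε ∈ classIndexSet μ ε := by
    rw [classIndex, if_pos hne]
    exact Nat.sInf_mem hne
  obtain ⟨h1, -, h3, -⟩ := hmem
  refine ⟨h1, fun k hk => lt_of_not_ge fun hc => hk ?_⟩
  have := sortedGap_le_sortedGap (one_le_gapIndex μ k) hc hi.le
  rw [← gap_eq] at this
  change maxMean μ - ε ≤ μ k
  linarith

/-- Going up from Δ_1 = 0 ≤ ε, the first gap exceeding ε would put its predecessor into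
`classIndexSet`; hence all gaps are at most ε. -/
theorem mem_goodArms_of_classIndex_ge {ε : ℝ} (hK : 0 < K) (hε : 0 ≤ ε)
    (hi : ¬ classIndex μ ε < numClasses μ) (k : Fin K) : k ∈ goodArms μ ε := by
  have key : ∀ m, 1 ≤ m → m ≤ numClasses μ → sortedGap μ m ≤ ε := by
    intro m h1
    induction m, h1 using Nat.le_induction with
    | base => intro _; rwa [sortedGap_one hK]
    | succ m hm ih =>
      intro hmn
      by_contra hc
      have hmem : m ∈ classIndexSet μ ε := ⟨hm, hmn, ih (by omega), not_le.1 hc⟩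
      apply hi
      rw [classIndex, if_pos ⟨m, hmem⟩]
      exact (Nat.sInf_le hmem).trans_lt hmn
  have := key _ (one_le_gapIndex μ k) (gapIndex_le μ k)
  rw [← gap_eq] at this
  change maxMean μ - ε ≤ μ k
  linarith

end Gaps

/-! ### The Lambert function -/

section Lambert

/-- With w = -y, the equation w e^w = -e^{-x} reads y - log y = x. A solution exists in [1, 2x] by
intermediate values; its uniqueness is not needed. -/
theorem lambertWBar_spec {x : ℝ} (hx : 1 ≤ x) :
    1 ≤ lambertWBar x ∧ lambertWBar x - Real.log (lambertWBar x) = x := by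
  have hex : ∃ w ∈ Set.Iic (-1 : ℝ), w * Real.exp w = - Real.exp (-x) := by
    have hcont : ContinuousOn (fun y : ℝ => y - Real.log y) (Set.Icc 1 (2 * x)) :=
      continuousOn_id.sub (Real.continuousOn_log.mono fun y hy => by
        have : (1 : ℝ) ≤ y := hy.1
        simp only [Set.mem_compl_iff, Set.mem_singleton_iff]
        linarith)
    have h2 : x ≤ 2 * x - Real.log (2 * x) := by
      have h3 := Real.log_le_sub_one_of_pos (by norm_num : (0 : ℝ) < 2)
      have h4 := Real.log_le_sub_one_of_pos (by linarith : (0 : ℝ) < x)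
      rw [Real.log_mul (by norm_num) (by linarith)]
      linarith
    obtain ⟨y, ⟨hy1, -⟩, hy⟩ := intermediate_value_Icc (by linarith : (1 : ℝ) ≤ 2 * x) hcont
      (show x ∈ Set.Icc _ _ from ⟨by simpa using hx, h2⟩)
    have hy' : y - Real.log y = x := hy
    refine ⟨-y, by simpa using hy1, ?_⟩
    rw [neg_mul, ← hy', neg_sub, sub_eq_add_neg, Real.exp_add, Real.exp_log (by linarith)]
  have h1 : lambertWNegOne (- Real.exp (-x)) ≤ -1 := Function.invFunOn_mem hex
  have h2 : lambertWNegOne (- Real.exp (-x)) * Real.exp (lambertWNegOne (- Real.exp (-x)))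
      = - Real.exp (-x) := Function.invFunOn_eq hex
  rw [lambertWBar]
  generalize lambertWNegOne (- Real.exp (-x)) = w at h1 h2
  refine ⟨by linarith, ?_⟩
  have h3 : (-w) * Real.exp w = Real.exp (-x) := by linarith
  have h4 := congrArg Real.log h3
  rw [Real.log_mul (by linarith) (Real.exp_pos _).ne', Real.log_exp, Real.log_exp] at h4
  linarith

theorem lambertWBar_le {x : ℝ} (hx : 1 ≤ x) : lambertWBar x ≤ 2 * x := by
  obtain ⟨h1, h2⟩ := lambertWBar_spec hx
  have h3 := Real.log_le_sub_one_of_pos (by linarith : (0 : ℝ) < lambertWBar x / 2)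
  rw [Real.log_div (by linarith) (by norm_num)] at h3
  have h4 := Real.log_le_sub_one_of_pos (by norm_num : (0 : ℝ) < 2)
  linarith

/-- In terms of z = x / (2A) the conclusion says that z - log z exceeds the argument of
`lambertWBar`, and z - log z is increasing on [1, ∞). -/
theorem lt_of_hTwo_lt {L A B x : ℝ} (hA : 0 < A)
    (h1 : 1 ≤ 1 / 2 * L + B / (2 * A) + Real.log (2 * A)) (hx : hTwo L A B < x) :
    A * L + B + 2 * A * Real.log x < x := by
  obtain ⟨h2, h3⟩ := lambertWBar_spec h1
  rw [hTwo] at hx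
  set y := lambertWBar (1 / 2 * L + B / (2 * A) + Real.log (2 * A))
  obtain ⟨z, rfl⟩ : ∃ z, x = 2 * A * z := ⟨x / (2 * A), by field_simp⟩
  have hyz : y < z := lt_of_mul_lt_mul_left hx (by positivity)
  have hz : 0 < z := by linarith
  have h4 : Real.log z - Real.log y < z - y := by
    rw [← Real.log_div (by linarith) (by linarith)]
    have h5 := Real.log_lt_sub_one_of_pos (by positivity : 0 < z / y)
      ((one_lt_div (by linarith)).2 hyz).ne'
    have h6 : z / y - 1 ≤ z - y := by
      rw [div_sub_one (by linarith), div_le_iff₀ (by linarith)]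
      nlinarith
    linarith
  rw [Real.log_mul (by positivity) hz.ne']
  have h5 : 1 / 2 * L + B / (2 * A) + Real.log (2 * A) + Real.log z < z := by linarith
  have h6 := mul_lt_mul_of_pos_left h5 (by positivity : 0 < 2 * A)
  have h7 : 2 * A * (1 / 2 * L + B / (2 * A) + Real.log (2 * A) + Real.log z)
      = A * L + B + 2 * A * (Real.log (2 * A) + Real.log z) := by
    field_simp
    ring
  linarith

/-- Substituting y = x + log y, the difference is B + 2A log(2A) + 2A log y, and y ≤ 2x ≤ 2L ≤ L².
The lower bound on L also ensures log L ≥ 1, which absorbs the constants. -/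
theorem abs_hTwo_sub_le {L A B : ℝ} (hA : 0 < A)
    (hL : |B / A + 2 * Real.log (2 * A)| + 3 ≤ L) :
    |hTwo L A B - A * L| ≤ (|B + 2 * A * Real.log (2 * A)| + 4 * A) * Real.log L := by
  have h0 := abs_le.1 (le_refl |B / A + 2 * Real.log (2 * A)|)
  have hc : 1 / 2 * L + B / (2 * A) + Real.log (2 * A)
      = (L + (B / A + 2 * Real.log (2 * A))) / 2 := by
    field_simp
    ring
  have h1 : 1 ≤ 1 / 2 * L + B / (2 * A) + Real.log (2 * A) := by rw [hc]; linarith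
  obtain ⟨h2, h3⟩ := lambertWBar_spec h1
  have h4 := lambertWBar_le h1
  rw [hTwo]
  set y := lambertWBar (1 / 2 * L + B / (2 * A) + Real.log (2 * A))
  have hL3 : 3 ≤ L := by linarith [abs_nonneg (B / A + 2 * Real.log (2 * A))]
  have e : 2 * A * y - A * L = (B + 2 * A * Real.log (2 * A)) + 2 * A * Real.log y := by
    have : y = 1 / 2 * L + B / (2 * A) + Real.log (2 * A) + Real.log y := by linarith
    calc 2 * A * y - A * L
        = 2 * A * (1 / 2 * L + B / (2 * A) + Real.log (2 * A) + Real.log y) - A * L := by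
          rw [← this]
      _ = _ := by field_simp; ring
  have hy0 : 0 ≤ Real.log y := Real.log_nonneg h2
  have hy1 : Real.log y ≤ 2 * Real.log L := by
    have h5 : y ≤ L ^ 2 := by
      have : y ≤ 2 * L := by rw [hc] at h4; linarith
      nlinarith
    calc Real.log y ≤ Real.log (L ^ 2) := Real.log_le_log (by linarith) h5
      _ = 2 * Real.log L := by rw [Real.log_pow]; norm_num
  have hlog : 1 ≤ Real.log L := by
    rw [Real.le_log_iff_exp_le (by linarith)]
    linarith [Real.exp_one_lt_d9]
  rw [e]
  calc |B + 2 * A * Real.log (2 * A) + 2 * A * Real.log y|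
      ≤ |B + 2 * A * Real.log (2 * A)| + |2 * A * Real.log y| := abs_add_le _ _
    _ = |B + 2 * A * Real.log (2 * A)| + 2 * A * Real.log y := by
        rw [abs_of_nonneg (by positivity : 0 ≤ 2 * A * Real.log y)]
    _ ≤ |B + 2 * A * Real.log (2 * A)| * Real.log L + 2 * A * (2 * Real.log L) :=
        add_le_add (le_mul_of_one_le_right (abs_nonneg _) hlog)
          (mul_le_mul_of_nonneg_left hy1 (by positivity))
    _ = _ := by ring

theorem hTwo_sub_isBigO (A B : ℝ) (hA : 0 < A) :
    (fun δ : ℝ => hTwo (Real.log (1 / δ)) A B - A * Real.log (1 / δ))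
      =O[𝓝[>] 0] fun δ : ℝ => Real.log (Real.log (1 / δ)) := by
  have ht : Tendsto (fun δ : ℝ => Real.log (1 / δ)) (𝓝[>] 0) atTop := by
    simp_rw [one_div]
    exact Real.tendsto_log_atTop.comp tendsto_inv_nhdsGT_zero
  refine IsBigO.of_bound (|B + 2 * A * Real.log (2 * A)| + 4 * A) ?_
  filter_upwards [ht.eventually_ge_atTop (|B / A + 2 * Real.log (2 * A)| + 3)] with δ hδ
  rw [Real.norm_eq_abs, Real.norm_eq_abs]
  exact (abs_hTwo_sub_le hA hδ).trans (mul_le_mul_of_nonneg_left (le_abs_self _) (by positivity))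

end Lambert

/-! ### Behaviour of the algorithm under concentration -/

section Concentrated

/-- Origin of the threshold 4 f M²: once both pull counts exceed it, the confidence width of the
difference is below 1/M. -/
theorem sqrt_mul_sqrt_mul_lt_one {f M x y : ℝ} (hf : 0 < f) (hM : 0 < M)
    (hx : 4 * f * M ^ 2 < x) (hy : 4 * f * M ^ 2 < y) :
    Real.sqrt (2 * f) * Real.sqrt (1 / x + 1 / y) * M < 1 := by
  have h0 : 0 < 4 * f * M ^ 2 := by positivity
  have h1 : 1 / x + 1 / y < 1 / (2 * f * M ^ 2) := by
    have := one_div_lt_one_div_of_lt h0 hx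
    have := one_div_lt_one_div_of_lt h0 hy
    have e : 1 / (2 * f * M ^ 2) = 1 / (4 * f * M ^ 2) + 1 / (4 * f * M ^ 2) := by
      field_simp
      norm_num
    linarith
  have h2 : 2 * f * (1 / x + 1 / y) * M ^ 2 < 1 := by
    have h3 := mul_lt_mul_of_pos_left h1 (by positivity : 0 < 2 * f * M ^ 2)
    rw [mul_one_div_cancel (by positivity)] at h3
    linarith
  have h4 : 0 < 1 / x + 1 / y := by
    have : 0 < x := h0.trans hx
    have : 0 < y := h0.trans hy
    positivity
  refine lt_of_pow_lt_pow_left₀ 2 zero_le_one ?_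
  rw [mul_pow, mul_pow, Real.sq_sqrt (by positivity), Real.sq_sqrt h4.le]
  linarith

variable {Ω : Type*} {K : ℕ} [MeasurableSpace Ω] {P : Measure Ω} {ν : Fin K → Measure ℝ} {ε₀ : ℝ}
  {ihat C I : ℕ → Ω → Fin K} {X : ℕ → Ω → ℝ}

/-- In a round with a bad leader, leader or challenger has been pulled seldom. -/
theorem IsEBTCRun.pulls_le_or_pulls_le (h : IsEBTCRun P ν ε₀ (1 / 2) ihat C I X) (hK : 2 ≤ K)
    (hε₀ : 0 < ε₀) {μ : Fin K → ℝ} {T : ℕ} {f : ℝ} (hf : 0 < f) {σ y : Fin K → ℝ} {ω : Ω}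
    (hω : IsConcentrated μ I X T f σ y ω) {t : ℕ} (hKt : K < t) (htT : t ≤ T) {Δ : ℝ}
    (hΔ : 0 < Δ) (hgap : Δ ≤ maxMean μ - μ (ihat t ω)) {d : Fin K → ℝ}
    (hd1 : ∀ k, μ k = maxMean μ → Δ⁻¹ ≤ d k)
    (hd2 : ∀ k, μ k ≠ maxMean μ → max Δ⁻¹ ε₀⁻¹ ≤ d k) :
    (pulls I t (ihat t ω) ω : ℝ) ≤ 4 * f * d (ihat t ω) ^ 2 ∨
      (pulls I t (C t ω) ω : ℝ) ≤ 4 * f * d (C t ω) ^ 2 := by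
  by_contra! hcon
  obtain ⟨hb, hc⟩ := hcon
  have hmax := h.ihat_max ω t hKt
  have hmin := h.challenger_min ω t hKt
  have hne := h.challenger_ne ω t hKt
  set b := ihat t ω
  set c := C t ω
  have hΔi : 0 < Δ⁻¹ := by positivity
  have hb1 : μ b ≠ maxMean μ := fun e => by rw [e] at hgap; linarith
  have hbig : ∀ {k : Fin K} {M : ℝ}, 0 < M → M ≤ d k → 4 * f * d k ^ 2 < pulls I t k ω →
      4 * f * M ^ 2 < pulls I t k ω := fun {k M} hM hMd hk =>
    lt_of_le_of_lt (by gcongr) hk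
  -- Against a best challenger the width is below Δ, so the leader could not be empirically ahead.
  -- Here ε₀ plays no role, which is why `hd1` is weaker than `hd2`.
  by_cases hc1 : μ c = maxMean μ
  · have h1 := sqrt_mul_sqrt_mul_lt_one hf hΔi
      (hbig hΔi ((le_max_left _ _).trans (hd2 b hb1)) hb) (hbig hΔi (hd1 c hc1) hc)
    have h2 := hω.1 b c hne.symm t hKt htT
    have h3 := hmax c
    rw [← div_eq_mul_inv, div_lt_one hΔ] at h1
    linarith
  · set M := max Δ⁻¹ ε₀⁻¹ with hM
    have hM0 : 0 < M := hΔi.trans_le (le_max_left _ _)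
    have h1 := sqrt_mul_sqrt_mul_lt_one hf hM0 (hbig hM0 (hd2 b hb1) hb) (hbig hM0 (hd2 c hc1) hc)
    -- Otherwise the challenger is compared with a best arm k: its cost exceeds ε₀ r M, hence so
    -- does the cost of k by minimality.
    obtain ⟨k, hk⟩ := exists_eq_maxMean (by omega) μ
    have hbk : b ≠ k := fun e => hb1 (e ▸ hk)
    have h2 := hω.1 b k hbk t hKt htT
    have h3 := hmax k
    have h4 := hmax c
    have h5 := hmin k hbk.symm
    rw [transportCost, transportCost] at h5
    have hN : ∀ k', (0 : ℝ) < pulls I t k' ω := fun k' => by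
      exact_mod_cast one_le_pulls (h.init ω) hKt k'
    have hs1 : 0 < Real.sqrt (1 / (pulls I t b ω : ℝ) + 1 / (pulls I t c ω : ℝ)) :=
      Real.sqrt_pos.2 (add_pos (one_div_pos.2 (hN b)) (one_div_pos.2 (hN c)))
    have hs2 : 0 < Real.sqrt (1 / (pulls I t b ω : ℝ) + 1 / (pulls I t k ω : ℝ)) :=
      Real.sqrt_pos.2 (add_pos (one_div_pos.2 (hN b)) (one_div_pos.2 (hN k)))
    set s1 := Real.sqrt (1 / (pulls I t b ω : ℝ) + 1 / (pulls I t c ω : ℝ))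
    set s2 := Real.sqrt (1 / (pulls I t b ω : ℝ) + 1 / (pulls I t k ω : ℝ))
    set r := Real.sqrt (2 * f)
    have h6 : ε₀ * (r * M) < ε₀ / s1 := by
      rw [lt_div_iff₀ hs1]
      nlinarith
    have h7 : ε₀ / s1 ≤ (empMean I X t b ω - empMean I X t c ω + ε₀) / s1 :=
      div_le_div_of_nonneg_right (by linarith) hs1.le
    have h8 := h6.trans_le (h7.trans h5)
    rw [lt_div_iff₀ hs2] at h8
    have hM1 : 1 ≤ M * Δ := by
      rw [← inv_mul_cancel₀ hΔ.ne']
      exact mul_le_mul_of_nonneg_right (le_max_left _ _) hΔ.le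
    have hM2 : 1 ≤ M * ε₀ := by
      rw [← inv_mul_cancel₀ hε₀.ne']
      exact mul_le_mul_of_nonneg_right (le_max_right _ _) hε₀.le
    have h9 : maxMean μ - μ b < r * s2 := by linarith
    have hM3 : 1 ≤ M * (maxMean μ - μ b) :=
      hM1.trans (mul_le_mul_of_nonneg_left hgap hM0.le)
    -- With G the gap of b, the cost bound gives (Mε₀ - 1) r s₂ < ε₀ - G. Inserting r s₂ > G yields
    -- M G < 1, against `hM3`; M ≥ 1/ε₀ gives the sign needed.
    have h10 := mul_le_mul_of_nonneg_right h9.le (by linarith : 0 ≤ M * ε₀ - 1)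
    have h11 := mul_le_mul_of_nonneg_right hM3 hε₀.le
    linarith

/-- A round with a good leader, in which leader and challenger have been pulled often: then all
the arms with a large gap have been pulled often. -/
theorem IsEBTCRun.le_pulls_mul (h : IsEBTCRun P ν ε₀ (1 / 2) ihat C I X)
    (hε₀ : 0 < ε₀) {μ : Fin K → ℝ} {T : ℕ} {f : ℝ} (hf : 0 < f) {σ y : Fin K → ℝ} {ω : Ω}
    (hω : IsConcentrated μ I X T f σ y ω) {t : ℕ} (hKt : K < t) (htT : t ≤ T) {Δ₁ Δ₂ c : ℝ}
    (hΔ₁ : 0 ≤ Δ₁) (hΔ : Δ₁ < Δ₂) (hlead : maxMean μ - μ (ihat t ω) ≤ Δ₁)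
    (hc : c = 2 * ((Δ₁ / ε₀ + 1) / (Δ₂ - Δ₁)) + 3 * ε₀⁻¹)
    (hb : 4 * f * c ^ 2 < pulls I t (ihat t ω) ω) (hC : 4 * f * c ^ 2 < pulls I t (C t ω) ω)
    {k : Fin K} (hk : Δ₂ ≤ maxMean μ - μ k) :
    f ≤ pulls I t k ω * (((maxMean μ - μ k - Δ₁) / 2) ^ 2 / 2) := by
  have hmax := h.ihat_max ω t hKt (C t ω)
  have hmin := h.challenger_min ω t hKt
  set b := ihat t ω
  have hbk : b ≠ k := fun e => by rw [e] at hlead; linarith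
  have h1 := hω.1 b k hbk t hKt htT
  have h2 := hmin k hbk.symm
  have hb1 := le_maxMean μ b
  rw [transportCost, transportCost] at h2
  have hN : ∀ k', (0 : ℝ) < pulls I t k' ω := fun k' => by
    exact_mod_cast one_le_pulls (h.init ω) hKt k'
  have he : 0 < Δ₂ - Δ₁ := by linarith
  have hc0 : 0 < c := by rw [hc]; positivity
  have h3 := sqrt_mul_sqrt_mul_lt_one hf hc0 hb hC
  have hs1 : 0 < Real.sqrt (1 / (pulls I t b ω : ℝ) + 1 / (pulls I t (C t ω) ω : ℝ)) :=
    Real.sqrt_pos.2 (add_pos (one_div_pos.2 (hN b)) (one_div_pos.2 (hN _)))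
  have hs2 : 0 < Real.sqrt (1 / (pulls I t b ω : ℝ) + 1 / (pulls I t k ω : ℝ)) :=
    Real.sqrt_pos.2 (add_pos (one_div_pos.2 (hN b)) (one_div_pos.2 (hN k)))
  -- The width is at least 1/√N_k. Thus a small N_k would make the cost of k smaller than that of
  -- the challenger.
  have hs3 : 1 ≤ Real.sqrt (1 / (pulls I t b ω : ℝ) + 1 / (pulls I t k ω : ℝ))
      * Real.sqrt (pulls I t k ω) := by
    rw [← Real.sqrt_mul (add_pos (one_div_pos.2 (hN b)) (one_div_pos.2 (hN k))).le,
      Real.one_le_sqrt, add_mul, one_div_mul_cancel (hN k).ne']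
    have := hN b
    have := hN k
    exact le_add_of_nonneg_left (by positivity)
  set s1 := Real.sqrt (1 / (pulls I t b ω : ℝ) + 1 / (pulls I t (C t ω) ω : ℝ))
  set s2 := Real.sqrt (1 / (pulls I t b ω : ℝ) + 1 / (pulls I t k ω : ℝ))
  set q := Real.sqrt (pulls I t k ω) with hq
  have hr0 : 0 < Real.sqrt (2 * f) := Real.sqrt_pos.2 (by positivity)
  have hr2 : Real.sqrt (2 * f) ^ 2 = 2 * f := Real.sq_sqrt (by positivity)
  set r := Real.sqrt (2 * f)
  have hq2 : q ^ 2 = pulls I t k ω := Real.sq_sqrt (hN k).le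
  have h6 : ε₀ * (r * c) < ε₀ / s1 := by
    rw [lt_div_iff₀ hs1]
    nlinarith
  have h7 : ε₀ / s1 ≤ (empMean I X t b ω - empMean I X t (C t ω) ω + ε₀) / s1 :=
    div_le_div_of_nonneg_right (by linarith) hs1.le
  have h8 := h6.trans_le (h7.trans h2)
  rw [lt_div_iff₀ hs2] at h8
  set g := maxMean μ - μ k with hg
  have h9 : ε₀ * (r * c) * s2 < g + ε₀ + r * s2 := by linarith
  have h10 : g + ε₀ ≤ (g + ε₀) * (s2 * q) := le_mul_of_one_le_right (by linarith) hs3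
  have h11 : r * (ε₀ * c - 1) < (g + ε₀) * q := by
    refine lt_of_mul_lt_mul_right ?_ hs2.le
    linarith
  have he' : 0 < g - Δ₁ := by linarith
  -- This dictates the form of c: the left side decreases in g and equals ε₀ c - 1 at g = Δ₂, the
  -- term 3/ε₀ supplying 1 + 2.
  have h12 : 2 * (g + ε₀) / (g - Δ₁) ≤ ε₀ * c - 1 := by
    have e1 : ε₀ * c - 1 = 2 * (Δ₁ + ε₀) / (Δ₂ - Δ₁) + 2 := by
      rw [hc]
      field_simp
      ring
    have e2 : 2 * (g + ε₀) / (g - Δ₁) = 2 * (Δ₁ + ε₀) / (g - Δ₁) + 2 := by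
      field_simp
      ring
    rw [e1, e2]
    have : 2 * (Δ₁ + ε₀) / (g - Δ₁) ≤ 2 * (Δ₁ + ε₀) / (Δ₂ - Δ₁) :=
      div_le_div_of_nonneg_left (by positivity) he (by linarith)
    linarith
  have h13 : (g + ε₀) * (2 * r) < (g + ε₀) * (q * (g - Δ₁)) := by
    have := (mul_le_mul_of_nonneg_left h12 hr0.le).trans_lt h11
    rw [mul_div_assoc', div_lt_iff₀ he'] at this
    linarith
  have h14 : 2 * r < q * (g - Δ₁) := lt_of_mul_lt_mul_left h13 (by linarith)
  have h15 := pow_lt_pow_left₀ h14 (by positivity) two_ne_zero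
  rw [mul_pow, mul_pow, hr2, hq2] at h15
  linarith

/-- From the time `T` on, all recommended arms belong to the classes up to `i`. -/
theorem IsEBTCRun.gapIndex_ihat_le (h : IsEBTCRun P ν ε₀ (1 / 2) ihat C I X) (hK : 2 ≤ K)
    (hε₀ : 0 < ε₀) {μ : Fin K → ℝ} {i j : ℕ} (hj : 1 ≤ j) (hji : j ≤ i) (hi : i < numClasses μ)
    {T : ℕ} (hKT : K < T) {f : ℝ} (hf : 0 < f)
    (hT : 8 * max (hBar μ ε₀ i j) (hTilde μ ε₀ i j) * f + 5 * (K : ℝ) ^ 2 / 2 < T) {ω : Ω}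
    (hω : IsConcentrated μ I X T f (fun k => if gapIndex μ k ≤ i then -1 else 1)
      (fun k => if gapIndex μ k ≤ i then (sortedGap μ (i + 1) - sortedGap μ j) / 2
        else (maxMean μ - μ k - sortedGap μ j) / 2) ω) {n : ℕ} (hn : T ≤ n) :
    gapIndex μ (ihat n ω) ≤ i := by
  have hK0 : 0 < K := by omega
  have hΔ0 := sortedGap_nonneg (μ := μ) hj (by omega)
  have hΔ1 := sortedGap_lt_sortedGap (μ := μ) hj (by omega : j < i + 1) hi
  have hidx : ∀ k, μ k = maxMean μ ↔ gapIndex μ k = 1 := fun k => by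
    rw [gapIndex_eq_iff le_rfl (numClasses_pos hK0 μ), sortedGap_one hK0]
    exact ⟨fun e => by linarith, fun e => by linarith⟩
  have hgap : ∀ k m, 1 ≤ m → m ≤ gapIndex μ k → sortedGap μ m ≤ maxMean μ - μ k :=
    fun k m h1 hm => by
      rw [gap_eq]
      exact sortedGap_le_sortedGap h1 hm (gapIndex_le μ k)
  have hgap' : ∀ k m, m ≤ numClasses μ → gapIndex μ k ≤ m → maxMean μ - μ k ≤ sortedGap μ m :=
    fun k m h1 hm => by
      rw [gap_eq]
      exact sortedGap_le_sortedGap (one_le_gapIndex μ k) hm h1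
  have hunder : ∀ d : ℕ → ℝ, (sortedGap μ (j + 1))⁻¹ ≤ d 1 →
      (∀ m, m ≠ 1 → max (sortedGap μ (j + 1))⁻¹ ε₀⁻¹ ≤ d m) →
      ∀ t, K < t → t < T → ¬ gapIndex μ (ihat t ω) ≤ j →
      (pulls I t (ihat t ω) ω : ℝ) ≤ 4 * f * d (gapIndex μ (ihat t ω)) ^ 2 ∨
      (pulls I t (C t ω) ω : ℝ) ≤ 4 * f * d (gapIndex μ (C t ω)) ^ 2 := by
    intro d hd1 hd2 t h1 h2 h3
    exact h.pulls_le_or_pulls_le hK hε₀ hf hω h1 h2.le (sortedGap_pos hK0 (by omega) (by omega))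
      (hgap _ _ (by omega) (by omega)) (d := fun k => d (gapIndex μ k))
      (fun k hk => by simpa only [(hidx k).1 hk] using hd1)
      (fun k hk => hd2 _ fun e => hk ((hidx k).2 e))
  have hD : ∀ d : ℕ → ℝ, ∀ k, 0 ≤ 4 * f * d (gapIndex μ k) ^ 2 := fun d k => by positivity
  -- The thresholds 4 f `barTerm`², doubled and summed, give 8 f `hBar`.
  obtain ⟨t, hKt, htT, hB, hC⟩ := h.exists_pulls_gt ω hK (T := T) (hD (barTerm μ ε₀ i j)) (by
    rw [← Finset.mul_sum, sum_barTerm hK0 μ ε₀ hj hji hi.le]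
    have := mul_le_mul_of_nonneg_right (le_max_left (hBar μ ε₀ i j) (hTilde μ ε₀ i j)) hf.le
    linarith)
  -- The value of q is the pull count from which the mean of k₀ is known within (Δ_{i+1} - Δ_j)/2;
  -- with it the total is 8 f `hTilde`.
  obtain ⟨k₀, hk₀, hq⟩ := h.exists_mem_pulls_ge ω hK hKT (hD (tildeTerm μ ε₀ j))
    (Finset.univ.filter (fun k => gapIndex μ k ≤ j))
    (q := 8 * f / (sortedGap μ (i + 1) - sortedGap μ j) ^ 2)
    (fun t h1 h2 h3 => hunder _ (inv_le_tildeTerm_one hK0 ε₀ hj (by omega))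
      (fun m hm => max_inv_le_tildeTerm μ ε₀ j hm) t h1 h2 (by simpa using h3)) (by
    have e := sum_tildeTerm hK0 μ ε₀ (i := i) hj (by omega)
    have h1 := mul_le_mul_of_nonneg_right (le_max_right (hBar μ ε₀ i j) (hTilde μ ε₀ i j)) hf.le
    rw [← Finset.mul_sum]
    refine lt_of_eq_of_lt ?_ (lt_of_le_of_lt (add_le_add_left (mul_le_mul_of_nonneg_left h1
      (by norm_num : (0 : ℝ) ≤ 8)) (5 * (K : ℝ) ^ 2 / 2)) (by linarith))
    rw [← e]
    ring)
  have hk₀j : gapIndex μ k₀ ≤ j := (Finset.mem_filter.1 hk₀).2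
  have hleadj : gapIndex μ (ihat t ω) ≤ j := by
    by_contra hc
    rcases hunder _ (inv_le_barTerm_one hK0 ε₀ i hj (by omega))
      (fun m hm => max_inv_le_barTerm hε₀ hj hji hi hm) t hKt htT hc with h' | h'
    · exact absurd h' (not_le.2 hB)
    · exact absurd h' (not_le.2 hC)
  by_contra hcon
  set b := ihat n ω with hb
  have hbgap := hgap b (i + 1) (by omega) (by omega)
  have hcT : 0 < cTwo μ ε₀ (i + 1) j :=
    (inv_pos.2 hε₀).trans_le (inv_le_cTwo hε₀ hj hji hi)
  have hbarT : ∀ m, 4 * f * cTwo μ ε₀ (i + 1) j ^ 2 ≤ 4 * f * barTerm μ ε₀ i j m ^ 2 := fun m =>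
    mul_le_mul_of_nonneg_left (pow_le_pow_left₀ hcT.le (cTwo_le_barTerm μ ε₀ i j m) 2)
      (by positivity)
  have hpb := h.le_pulls_mul hε₀ hf hω hKt htT.le hΔ0 hΔ1 (hgap' _ _ (by omega) hleadj)
    (c := cTwo μ ε₀ (i + 1) j) rfl ((hbarT _).trans_lt hB) ((hbarT _).trans_lt hC) hbgap
  have h1 := hω.2 b n (by
    simp only [if_neg hcon]
    refine hpb.trans (mul_le_mul_of_nonneg_right ?_ (by positivity))
    exact_mod_cast pulls_mono I b ω (htT.le.trans hn))
  have h2 := hω.2 k₀ n (by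
    simp only [if_pos (hk₀j.trans hji)]
    have h3 : 8 * f / (sortedGap μ (i + 1) - sortedGap μ j) ^ 2 ≤ pulls I n k₀ ω :=
      hq.trans (by exact_mod_cast pulls_mono I k₀ ω hn)
    rw [div_le_iff₀ (pow_pos (by linarith) 2)] at h3
    linarith)
  simp only [if_neg hcon] at h1
  simp only [if_pos (hk₀j.trans hji)] at h2
  -- The mean of b lies below the midpoint of μ_b and μ⋆ - Δ_j, hence below μ⋆ - (Δ_{i+1} + Δ_j)/2,
  -- while that of k₀ lies above this level.
  have h3 := h.ihat_max ω n (hKT.trans_le hn) k₀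
  have h4 := hgap' k₀ j (by omega) hk₀j
  linarith

end Concentrated

/-! ### The sample complexity -/

section Main

/-- For small A the negative logarithm satisfies log(2A) ≥ 1 - 1/(2A), and the term in K²
compensates the 1/(2A). -/
theorem hTwo_arg_ge_one {L A : ℝ} {K : ℕ} (hK : 2 ≤ K) (hL : 0 ≤ L) (hA : 0 < A) :
    1 ≤ 1 / 2 * L + (A * Real.log ((K : ℝ) * ((K : ℝ) + 1) / 2) + 5 * (K : ℝ) ^ 2 / 2) / (2 * A)
      + Real.log (2 * A) := by
  have hK' : (2 : ℝ) ≤ K := by exact_mod_cast hK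
  have h1 : 0 ≤ Real.log ((K : ℝ) * ((K : ℝ) + 1) / 2) := Real.log_nonneg (by nlinarith)
  have h2 := Real.one_sub_inv_le_log_of_pos (by positivity : 0 < 2 * A)
  have h3 : (A * Real.log ((K : ℝ) * ((K : ℝ) + 1) / 2) + 5 * (K : ℝ) ^ 2 / 2) / (2 * A)
      = Real.log ((K : ℝ) * ((K : ℝ) + 1) / 2) / 2 + 5 * (K : ℝ) ^ 2 / 2 * (2 * A)⁻¹ := by
    field_simp
  have h4 : 1 * (2 * A)⁻¹ ≤ 5 * (K : ℝ) ^ 2 / 2 * (2 * A)⁻¹ :=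
    mul_le_mul_of_nonneg_right (by nlinarith) (by positivity)
  linarith

variable {Ω : Type*} {K : ℕ}

/-- The level of concentration for the horizon `T`. -/
noncomputable def confidenceLevel (K T : ℕ) (δ : ℝ) : ℝ :=
  Real.log (1 / δ) + Real.log ((K : ℝ) * ((K : ℝ) + 1) / 2) + 2 * Real.log T

theorem exp_neg_confidenceLevel {K T : ℕ} (hK : 0 < K) (hT : 0 < T) {δ : ℝ} (hδ : 0 < δ) :
    (K : ℝ) * (K + 1) / 2 * (T : ℝ) ^ 2 * Real.exp (-confidenceLevel K T δ) = δ := by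
  have hK' : (0 : ℝ) < K := by exact_mod_cast hK
  have hT' : (0 : ℝ) < T := by exact_mod_cast hT
  have e : confidenceLevel K T δ = Real.log (1 / δ * ((K : ℝ) * ((K : ℝ) + 1) / 2) * (T : ℝ) ^ 2) := by
    rw [Real.log_mul (by positivity) (by positivity), Real.log_mul (by positivity) (by positivity),
      Real.log_pow, confidenceLevel]
    norm_num
  rw [e, Real.exp_neg, Real.exp_log (by positivity)]
  field_simp

theorem one_le_confidenceLevel {K T : ℕ} (hK : 2 ≤ K) (hT : 0 < T) {δ : ℝ} (hδ : 0 < δ)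
    (hδ1 : δ < 1) : 1 ≤ confidenceLevel K T δ := by
  have hK' : (2 : ℝ) ≤ K := by exact_mod_cast hK
  have hT' : (1 : ℝ) ≤ T := by exact_mod_cast hT
  have h1 : 0 ≤ Real.log (1 / δ) := Real.log_nonneg (by rw [le_div_iff₀ hδ]; linarith)
  have h2 : 0 ≤ Real.log T := Real.log_nonneg hT'
  have h3 : 1 ≤ Real.log ((K : ℝ) * ((K : ℝ) + 1) / 2) := by
    rw [Real.le_log_iff_exp_le (by positivity)]
    nlinarith [Real.exp_one_lt_d9]
  rw [confidenceLevel]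
  linarith

theorem lt_of_unverifiableTime_lt (hK : 2 ≤ K) {μ : Fin K → ℝ} {ε₀ : ℝ} (hε₀ : 0 < ε₀) {i : ℕ}
    (h1 : 1 ≤ i) (hi : i < numClasses μ) {δ : ℝ} (hδ : 0 < δ) (hδ1 : δ < 1) {T : ℕ}
    (hT : unverifiableTime μ ε₀ i δ < T) :
    8 * complexityH μ ε₀ i * confidenceLevel K T δ + 5 * (K : ℝ) ^ 2 / 2 < T := by
  have hH := complexityH_pos (by omega) hε₀ h1 hi
  rw [unverifiableTime, if_pos hi] at hT
  have hL : 0 ≤ Real.log (1 / δ) := Real.log_nonneg (by rw [le_div_iff₀ hδ]; linarith)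
  have := lt_of_hTwo_lt (by positivity) (hTwo_arg_ge_one hK hL (by positivity)) hT
  rw [confidenceLevel]
  linarith

variable [mΩ : MeasurableSpace Ω] {P : Measure Ω} [IsProbabilityMeasure P]
  {ν : Fin K → Measure ℝ} {ε₀ : ℝ} {ihat C I : ℕ → Ω → Fin K} {X : ℕ → Ω → ℝ}

theorem IsEBTCRun.measure_gapIndex_ihat_le (h : IsEBTCRun P ν ε₀ (1 / 2) ihat C I X)
    (hK : 2 ≤ K) (hprob : ∀ k, IsProbabilityMeasure (ν k)) (hsub : ∀ k, IsOneSubGaussian (ν k))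
    (hε₀ : 0 < ε₀) {i : ℕ} (h1 : 1 ≤ i) (hi : i < numClasses (armMean ν)) {δ : ℝ} (hδ : 0 < δ)
    (hδ1 : δ < 1) {T : ℕ} (hT : unverifiableTime (armMean ν) ε₀ i δ < T) :
    K < T ∧ ENNReal.ofReal (1 - δ)
      ≤ P {ω | ∀ n, T ≤ n → gapIndex (armMean ν) (ihat n ω) ≤ i} := by
  set μ := armMean ν with hμ
  have hK0 : 0 < K := by omega
  have hK' : (2 : ℝ) ≤ K := by exact_mod_cast hK
  have hT1 := lt_of_unverifiableTime_lt hK hε₀ h1 hi hδ hδ1 hT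
  have hH := complexityH_pos hK0 hε₀ h1 hi
  -- T = 0 is excluded by hand: there `Real.log 0 = 0` keeps the level nonnegative, so the left side
  -- of `hT1` cannot be negative.
  have hT0 : 0 < T := by
    rcases Nat.eq_zero_or_pos T with rfl | h0
    · exfalso
      have h2 : 0 ≤ Real.log (1 / δ) := Real.log_nonneg (by rw [le_div_iff₀ hδ]; linarith)
      have h3 : 0 ≤ Real.log ((K : ℝ) * ((K : ℝ) + 1) / 2) := Real.log_nonneg (by nlinarith)
      have h4 : 0 ≤ confidenceLevel K 0 δ := by
        rw [confidenceLevel, Nat.cast_zero, Real.log_zero]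
        linarith
      have : 0 ≤ 8 * complexityH μ ε₀ i * confidenceLevel K 0 δ + 5 * (K : ℝ) ^ 2 / 2 := by
        positivity
      rw [Nat.cast_zero] at hT1
      linarith
    · exact h0
  have hf := one_le_confidenceLevel hK hT0 hδ hδ1
  have hexp := exp_neg_confidenceLevel hK0 hT0 hδ
  set f := confidenceLevel K T δ
  have hKT' : (K : ℝ) < T := by
    have : 0 ≤ 8 * complexityH μ ε₀ i * f := by positivity
    nlinarith
  have hKT : K < T := by exact_mod_cast hKT'
  refine ⟨hKT, ?_⟩
  obtain ⟨j, hj, hji, e⟩ := exists_complexityH_eq μ ε₀ h1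
  have hT2 := hT1
  rw [e] at hT2
  have hΔ1 := sortedGap_lt_sortedGap (μ := μ) hj (by omega : j < i + 1) hi
  set g := sortedGap μ (i + 1) - sortedGap μ j with hg
  have hg0 : 0 < g := by rw [hg]; linarith
  have hge : ∀ k, ¬ gapIndex μ k ≤ i → g ≤ maxMean μ - μ k - sortedGap μ j := fun k hk => by
    have := sortedGap_le_sortedGap (μ := μ) (by omega : 1 ≤ i + 1)
      (by omega : i + 1 ≤ gapIndex μ k) (gapIndex_le μ k)
    rw [← gap_eq] at this
    linarith
  have hy : ∀ k, g / 2 ≤ if gapIndex μ k ≤ i then g / 2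
      else (maxMean μ - μ k - sortedGap μ j) / 2 := by
    intro k
    split_ifs with hk
    · exact le_rfl
    · linarith [hge k hk]
  -- The class of best arms alone makes `hTilde` at least 2/g², so 8/g² ≤ 4 H_i f < T/2. The
  -- hypothesis on the widths thus costs nothing extra.
  have hgT : 1 + 1 / ((g / 2) ^ 2 / 2) ≤ (T : ℝ) ^ 2 := by
    have h3 := sum_tildeTerm hK0 μ ε₀ (i := i) hj (by omega)
    have h4 : (1 : ℝ) ≤ (Finset.univ.filter (fun k => gapIndex μ k ≤ j)).card := by
      rw [card_filter_gapIndex_le (by omega), Finset.sum_eq_sum_sdiff_singleton_add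
        (Finset.mem_Icc.2 ⟨le_rfl, hj⟩)]
      have h5 : (1 : ℝ) ≤ classSize μ 1 := by exact_mod_cast one_le_classSize_one hK0 μ
      have h6 : 0 ≤ ∑ m ∈ Finset.Icc 1 j \ {1}, (classSize μ m : ℝ) :=
        Finset.sum_nonneg fun _ _ => Nat.cast_nonneg _
      linarith
    have h5 : 0 ≤ ∑ k, tildeTerm μ ε₀ j (gapIndex μ k) ^ 2 :=
      Finset.sum_nonneg fun _ _ => sq_nonneg _
    have h6 : 2 / g ^ 2 ≤ hTilde μ ε₀ i j := by
      have := mul_le_mul_of_nonneg_right h4 (by positivity : 0 ≤ 2 / g ^ 2)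
      linarith
    have h7 : 2 / g ^ 2 ≤ max (hBar μ ε₀ i j) (hTilde μ ε₀ i j) * f :=
      (h6.trans (le_max_right _ _)).trans (le_mul_of_one_le_right
        (by rw [← e]; exact hH.le) hf)
    have h8 : 1 / ((g / 2) ^ 2 / 2) = 4 * (2 / g ^ 2) := by field_simp; norm_num
    rw [h8]
    nlinarith
  have hmain := h.one_le_measure_isConcentrated_add hprob hsub T (f := f) (by linarith)
    (σ := fun k => if gapIndex μ k ≤ i then -1 else 1)
    (y := fun k => if gapIndex μ k ≤ i then g / 2 else (maxMean μ - μ k - sortedGap μ j) / 2)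
    (fun k => by split_ifs <;> norm_num) (fun k => (half_pos hg0).trans_le (hy k))
    (fun k => le_trans (by
      have := hy k
      gcongr) hgT)
  rw [hexp] at hmain
  rw [ENNReal.ofReal_sub _ hδ.le, ENNReal.ofReal_one]
  refine tsub_le_iff_right.2 (hmain.trans (add_le_add_left (measure_mono fun ω hω n hn => ?_) _))
  exact h.gapIndex_ihat_le hK hε₀ hj hji hi hKT (by linarith) (by linarith) hω hn

/-- The probability that all recommendations after the time `unverifiableTime` are good. -/
theorem IsEBTCRun.measure_goodArms (h : IsEBTCRun P ν ε₀ (1 / 2) ihat C I X)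
    (hK : 2 ≤ K) (hprob : ∀ k, IsProbabilityMeasure (ν k)) (hsub : ∀ k, IsOneSubGaussian (ν k))
    (hε₀ : 0 < ε₀) {δ : ℝ} (hδ : 0 < δ) (hδ1 : δ < 1) {ε : ℝ} (hε : 0 ≤ ε) :
    K < ⌊unverifiableTime (armMean ν) ε₀ (classIndex (armMean ν) ε) δ⌋₊ + 1 ∧
    ENNReal.ofReal (1 - δ) ≤ P {ω | ∀ n : ℕ,
      ⌊unverifiableTime (armMean ν) ε₀ (classIndex (armMean ν) ε) δ⌋₊ + 1 ≤ n →
        ihat n ω ∈ goodArms (armMean ν) ε} := by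
  by_cases hi : classIndex (armMean ν) ε < numClasses (armMean ν)
  · obtain ⟨h1, h2⟩ := goodArms_classIndex_of_lt hi
    obtain ⟨h3, h4⟩ := h.measure_gapIndex_ihat_le hK hprob hsub hε₀ h1 hi hδ hδ1
      (T := ⌊unverifiableTime (armMean ν) ε₀ (classIndex (armMean ν) ε) δ⌋₊ + 1)
      (by exact_mod_cast Nat.lt_floor_add_one _)
    exact ⟨h3, h4.trans (measure_mono fun ω hω n hn =>
      by_contra fun hc => absurd (h2 _ hc) (not_lt.2 (hω n hn)))⟩
  · constructor
    -- Here U = K, so T = K + 1 is the first time with a recommendation.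
    · rw [unverifiableTime, if_neg hi, Nat.floor_natCast]
      omega
    · have e : {ω | ∀ n : ℕ,
          ⌊unverifiableTime (armMean ν) ε₀ (classIndex (armMean ν) ε) δ⌋₊ + 1 ≤ n →
          ihat n ω ∈ goodArms (armMean ν) ε} = Set.univ :=
        Set.eq_univ_of_forall fun ω n _ => mem_goodArms_of_classIndex_ge (by omega) hε hi _
      rw [e, measure_univ]
      exact ENNReal.ofReal_le_one.2 (by linarith)

end Main

theorem mainTheorem5 {Ω : Type*} [mΩ : MeasurableSpace Ω] (P : Measure Ω) [IsProbabilityMeasure P]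
    {K : ℕ} (hK : 2 ≤ K)
    (ν : Fin K → Measure ℝ) (hprob : ∀ k, IsProbabilityMeasure (ν k))
    (hsub : ∀ k, IsOneSubGaussian (ν k))
    (ε₀ : ℝ) (hε₀ : 0 < ε₀)
    (ihat C I : ℕ → Ω → Fin K) (X : ℕ → Ω → ℝ)
    (hrun : IsEBTCRun P ν ε₀ (1 / 2) ihat C I X) :
    (∀ δ : ℝ, 0 < δ → δ < 1 → ∀ ε : ℝ, 0 ≤ ε →
      ENNReal.ofReal (1 - δ) ≤
          P {ω | ∀ n : ℕ,
            unverifiableTime (armMean ν) ε₀ (classIndex (armMean ν) ε) δ < (n : ℝ) →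
              ihat n ω ∈ goodArms (armMean ν) ε}
        ∧ unverifiableSampleComplexity P
            (history I X hrun.measurable_arm hrun.measurable_reward) (armMean ν) ihat ε δ
          ≤ ((⌊unverifiableTime (armMean ν) ε₀ (classIndex (armMean ν) ε) δ⌋₊ + 1 : ℕ) : ℝ≥0∞))
    ∧ (∀ i : ℕ, 1 ≤ i → i < numClasses (armMean ν) →
        (fun δ : ℝ => unverifiableTime (armMean ν) ε₀ i δ
            - 8 * complexityH (armMean ν) ε₀ i * Real.log (1 / δ))
          =O[𝓝[>] 0] fun δ : ℝ => Real.log (Real.log (1 / δ)))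
    ∧ (∀ A B : ℝ, 0 < A →
        (fun δ : ℝ => hTwo (Real.log (1 / δ)) A B - A * Real.log (1 / δ))
          =O[𝓝[>] 0] fun δ : ℝ => Real.log (Real.log (1 / δ))) := by
  refine ⟨fun δ hδ hδ1 ε hε => ?_, fun i h1 hi => ?_, hTwo_sub_isBigO⟩
  · obtain ⟨h1, h2⟩ := hrun.measure_goodArms hK hprob hsub hε₀ hδ hδ1 hε
    set T := ⌊unverifiableTime (armMean ν) ε₀ (classIndex (armMean ν) ε) δ⌋₊ + 1 with hT
    constructor
    · refine h2.trans (measure_mono fun ω hω n hn => hω n ?_)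
      -- A negative U would give T = 1, contradicting K < T.
      have h3 : 0 ≤ unverifiableTime (armMean ν) ε₀ (classIndex (armMean ν) ε) δ := by
        by_contra hc
        rw [hT, Nat.floor_of_nonpos (not_le.1 hc).le] at h1
        omega
      exact (Nat.floor_lt h3).2 hn
    · rw [unverifiableSampleComplexity]
      -- The constant T is a competitor in the infimum, with expectation T.
      refine (iInf₂_le (fun _ : Ω => ((T : ℕ) : ℕ∞)) ⟨isStoppingTime_const _ T,
        fun _ => Nat.cast_lt.2 h1,
        h2.trans (measure_mono fun ω hω n hn => hω n (Nat.cast_le.1 hn))⟩).trans ?_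
      simp
  · have hH := complexityH_pos (by omega) hε₀ h1 hi
    simp only [unverifiableTime, if_pos hi]
    exact hTwo_sub_isBigO _ _ (by positivity)
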